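/- **Conventions.** A statistical manifold $(\hat M,\hat g,\hat\nabla,\hat\nabla^*)$ is a smooth Riemannian manifold with two smooth torsion-free affine connections such that $(\hat\nabla_X\hat g)(Y,Z)=(\hat\nabla_Y\hat g)(X,Z)$ and $X\hat g(Y,Z)=\hat g(\hat\nabla_XY,Z)+\hat g(Y,\hat\nabla^*_XZ)$; then $\hat\nabla^\circ=\frac12(\hat\nabla+\hat\nabla^*)$ is the Levi-Civita connection. $\hat R,\hat R^*,\hat R^\circ$ are the curvature tensors, $R(X,Y)Z=\nabla_X\nabla_YZ-\nabla_Y\nabla_XZ-\nabla_{[X,Y]}Z$. For a plane $\pi$ with orthonormal basis $X,Y$, $$K_\circ(\pi)=g(R^\circ(X,Y)Y,X),\qquad K(\pi)=\tfrac12\big[g(R(X,Y)Y,X)+g(R^*(X,Y)Y,X)-2g(R^\circ(X,Y)Y,X)\big].$$ Let $\hat M$ have dimension $4m$ and an almost quaternionic structure $\Lambda\subset \mathrm{End}(T\hat M)$, i.e. a bundle with local (canonical) bases $J_1,J_2,J_3$ satisfying $J_\alpha^2=-I$, $J_\alpha J_{\alpha+1}=-J_{\alpha+1}J_\alpha=J_{\alpha+2}$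 (indices mod 3). It is a quaternionic Kaehler-like statistical manifold (with constant $c\in\mathbb R$) if for every canonical local basis there are tensor fields $J_\alpha^*$ with $\hat g(J_\alpha X,Y)+\hat g(X,J^*_\alpha Y)=0$ and $1$-forms $\omega_\alpha$ with $(\hat\nabla_XJ_\alpha)Y=\omega_{\alpha+2}(X)J_{\alpha+1}Y-\omega_{\alpha+1}(X)J_{\alpha+2}Y$, and $$\hat R(X,Y)Z=\tfrac c4\Big\{\hat g(Y,Z)X-\hat g(X,Z)Y+\sum_{\alpha=1}^3\big[\hat g(Z,J_\alpha Y)J_\alpha X-\hat g(Z,J_\alpha X)J_\alpha Y\big]+\sum_{\alpha=1}^3\big[\hat g(X,J_\alpha Y)J_\alpha Z-\hat g(J_\alpha X,Y)J_\alpha Z\big]\Big\}.$$ An $n$-dimensional (immersed) statistical submanifold $(M,g,\nabla,\nabla^*)$ carries the induced metric and the induced connections given by the tangential parts in the Gauss formulae $\hat\nabla_XY=\nabla_XY+\sigma(X,Y)$, $\hat\nabla^*_XY=\nabla^*_XY+\sigma^*(X,Y)$. It is totally real if $J_\alpha(T_pM)\perp T_pM$ for all $p$ and $\alpha$. For an orthonormal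 basis $e_1,\dots,e_n$ of $T_pM$ put $H=\frac1n\sum_i\sigma(e_i,e_i)$, $H^*=\frac1n\sum_i\sigma^*(e_i,e_i)$, $\tau=\sum_{i<j}K(e_i\wedge e_j)$, $\tau_\circ=\sum_{i<j}K_\circ(e_i\wedge e_j)$ (computed on $M$), and $\hat\tau_\circ=\sum_{1\le i<j\le n}\hat K_\circ(e_i\wedge e_j)$, where $\hat K_\circ$ is the Riemannian sectional curvature of $\hat M$. $M$ is minimal if $H=H^*=0$ at every point. **Corollary.** Let $M$ be an $n$-dimensional totally real statistical submanifold of a quaternionic Kaehler-like statistical manifold $\hat M$ of dimension $4m$ with constant $c$ as above. Suppose that at some point $p\in M$ there are an orthonormal basis of $T_pM$ and mutually orthogonal planes $\pi_1,\pi_2\subset T_pM$, spanned by two disjoint pairs of vectors of this basis (so $n\ge 4$), such that $$\tau-\tau_\circ<\big(K(\pi_1)-K_\circ(\pi_1)\big)+\big(K(\pi_2)-K_\circ(\pi_2)\big)+(n^2-n-4)\frac c8-2\big(\hat\tau_\circ-\hat K_\circ(\pi_1)-\hat K_\circ(\pi_2)\big).$$ Then $M$ is not minimal. -/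

import Mathlib

open Bundle Manifold
open scoped ContDiff Topology

noncomputable section

namespace StatGeom

/-! ### Connections, curvature, statistical structures -/

section Statistical

variable {E : Type*} [NormedAddCommGroup E] [NormedSpace ℝ E]
  {H : Type*} [TopologicalSpace H] {I : ModelWithCorners ℝ E H}
  {M : Type*} [TopologicalSpace M] [ChartedSpace H M] [IsManifold I ∞ M]

/-- `R(X,Y)Z = ∇_X ∇_Y Z - ∇_Y ∇_X Z - ∇_{[X,Y]} Z` for vector fields `X, Y, Z`
(in Mathlib's convention `∇_X Z` at `x` is `cov Z x (X x)`). -/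
def curvatureField (cov : CovariantDerivative I E (TangentSpace I : M → Type _))
    (X Y Z : Π x : M, TangentSpace I x) (x : M) : TangentSpace I x :=
  cov (fun y ↦ cov Z y (Y y)) x (X x) - cov (fun y ↦ cov Z y (X y)) x (Y x)
    - cov Z x (VectorField.mlieBracket I X Y x)

/-- The curvature tensor at a point: `R(u,v)w` is computed from vector fields, smooth near `x`,
that extend the tangent vectors `u, v, w` (for a smooth connection the extensions do not
matter). -/
def curvature (cov : CovariantDerivative I E (TangentSpace I : M → Type _)) (x : M)
    (u v w : TangentSpace I x) : TangentSpace I x :=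
  curvatureField cov (FiberBundle.extend E u) (FiberBundle.extend E v) (FiberBundle.extend E w) x

variable [FiniteDimensional ℝ E] (I M)

/-- A statistical structure on a smooth manifold: a Riemannian metric `g` and two smooth
torsion-free affine connections `∇`, `∇*`, such that `(∇_X g)(Y,Z) = (∇_Y g)(X,Z)` and
`X g(Y,Z) = g(∇_X Y, Z) + g(Y, ∇*_X Z)`. -/
structure StatisticalStructure where
  metric : ContMDiffRiemannianMetric I ∞ E (TangentSpace I : M → Type _)
  conn : CovariantDerivative I E (TangentSpace I : M → Type _)
  dualConn : CovariantDerivative I E (TangentSpace I : M → Type _)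
  smooth_conn : CovariantDerivative.ContMDiffCovariantDerivative conn ∞
  smooth_dualConn : CovariantDerivative.ContMDiffCovariantDerivative dualConn ∞
  torsionFree_conn : conn.torsion = 0
  torsionFree_dualConn : dualConn.torsion = 0
  codazzi : ∀ (x : M) (X Y Z : Π y : M, TangentSpace I y),
    MDiffAt (T% X) x → MDiffAt (T% Y) x → MDiffAt (T% Z) x →
      mvfderiv I (fun y ↦ metric.inner y (Y y) (Z y)) x (X x)
          - metric.inner x (conn Y x (X x)) (Z x) - metric.inner x (Y x) (conn Z x (X x))
        = mvfderiv I (fun y ↦ metric.inner y (X y) (Z y)) x (Y x)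
          - metric.inner x (conn X x (Y x)) (Z x) - metric.inner x (X x) (conn Z x (Y x))
  duality : ∀ (x : M) (X Y Z : Π y : M, TangentSpace I y),
    MDiffAt (T% X) x → MDiffAt (T% Y) x → MDiffAt (T% Z) x →
      mvfderiv I (fun y ↦ metric.inner y (Y y) (Z y)) x (X x)
        = metric.inner x (conn Y x (X x)) (Z x) + metric.inner x (Y x) (dualConn Z x (X x))

variable {I M}

namespace StatisticalStructure

variable (S : StatisticalStructure I M)

/-- `∇° = (∇ + ∇*) / 2`; it is torsion-free and metric, i.e. it is the Levi-Civita connection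
of `g`. -/
def leviCivita : CovariantDerivative I E (TangentSpace I : M → Type _) :=
  CovariantDerivative.affineCombination S.conn S.dualConn (fun _ ↦ 1 / 2)

/-- The Riemannian sectional curvature `K°(u ∧ v) = g(R°(u,v)v, u)` of the plane with orthonormal
basis `u, v`. -/
def sectionalLC (x : M) (u v : TangentSpace I x) : ℝ :=
  S.metric.inner x (curvature S.leviCivita x u v v) u

/-- The sectional `K`-curvature
`K(u ∧ v) = ½ [g(R(u,v)v, u) + g(R*(u,v)v, u) - 2 g(R°(u,v)v, u)]` of the plane with orthonormal
basis `u, v`. -/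
def sectionalK (x : M) (u v : TangentSpace I x) : ℝ :=
  (1 / 2) * (S.metric.inner x (curvature S.conn x u v v) u
    + S.metric.inner x (curvature S.dualConn x u v v) u
    - 2 * S.metric.inner x (curvature S.leviCivita x u v v) u)

/-- `e` is an orthonormal family in the tangent space at `x`. -/
def IsOrthonormal {k : ℕ} (x : M) (e : Fin k → TangentSpace I x) : Prop :=
  ∀ i j, S.metric.inner x (e i) (e j) = if i = j then 1 else 0

/-- `∑_{i < j} K(e_i ∧ e_j)`. For an orthonormal basis `e` this is the scalar curvature `τ`. -/
def scalarK {k : ℕ} (x : M) (e : Fin k → TangentSpace I x) : ℝ :=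
  ∑ i, ∑ j ∈ Finset.Ioi i, S.sectionalK x (e i) (e j)

/-- `∑_{i < j} K°(e_i ∧ e_j)`. For an orthonormal basis `e` of the tangent space (or of a subspace
of it) this is the Riemannian scalar curvature `τ°` (of that subspace). -/
def scalarLC {k : ℕ} (x : M) (e : Fin k → TangentSpace I x) : ℝ :=
  ∑ i, ∑ j ∈ Finset.Ioi i, S.sectionalLC x (e i) (e j)

end StatisticalStructure

/-! ### Quaternionic structures -/

/-- `J 0, J 1, J 2` are smooth sections over the open set `U` of the bundle of endomorphisms of the
tangent bundle, span the fibres of `Λ` over `U`, and satisfy `J_α² = -1` and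
`J_α J_{α+1} = - J_{α+1} J_α = J_{α+2}` (indices modulo 3). -/
structure IsCanonicalBasisOn
    (Λ : Π x : M, Submodule ℝ (TangentSpace I x →L[ℝ] TangentSpace I x))
    (U : Set M) (J : Fin 3 → Π x : M, TangentSpace I x →L[ℝ] TangentSpace I x) : Prop where
  isOpen : IsOpen U
  smooth : ∀ α, ContMDiffOn I (I.prod 𝓘(ℝ, E →L[ℝ] E)) ∞
    (fun x ↦ TotalSpace.mk' (E →L[ℝ] E)
      (E := fun x : M ↦ TangentSpace I x →L[ℝ] TangentSpace I x) x (J α x)) U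
  span_eq : ∀ x ∈ U, Submodule.span ℝ (Set.range fun α ↦ J α x) = Λ x
  sq : ∀ x ∈ U, ∀ α, ∀ u : TangentSpace I x, J α x (J α x u) = -u
  mul : ∀ x ∈ U, ∀ α, ∀ u : TangentSpace I x, J α x (J (α + 1) x u) = J (α + 2) x u
  mul_rev : ∀ x ∈ U, ∀ α, ∀ u : TangentSpace I x, J (α + 1) x (J α x u) = -J (α + 2) x u

/-- `Λ` is an almost quaternionic structure: near every point it has a canonical basis. -/
def IsAlmostQuaternionic
    (Λ : Π x : M, Submodule ℝ (TangentSpace I x →L[ℝ] TangentSpace I x)) : Prop :=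
  ∀ x : M, ∃ U J, x ∈ U ∧ IsCanonicalBasisOn Λ U J

/-- Almost Hermite-like quaternionic manifold: every canonical basis `J` of `Λ` has companion tensor
fields `J*` with `g(J_α X, Y) + g(X, J*_α Y) = 0`. -/
def IsAlmostHermiteLike (S : StatisticalStructure I M)
    (Λ : Π x : M, Submodule ℝ (TangentSpace I x →L[ℝ] TangentSpace I x)) : Prop :=
  ∀ U J, IsCanonicalBasisOn Λ U J →
    ∃ Jstar : Fin 3 → Π x : M, TangentSpace I x →L[ℝ] TangentSpace I x,
      (∀ α, ContMDiffOn I (I.prod 𝓘(ℝ, E →L[ℝ] E)) ∞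
        (fun x ↦ TotalSpace.mk' (E →L[ℝ] E)
          (E := fun x : M ↦ TangentSpace I x →L[ℝ] TangentSpace I x) x (Jstar α x)) U) ∧
      ∀ x ∈ U, ∀ α, ∀ u v : TangentSpace I x,
        S.metric.inner x (J α x u) v + S.metric.inner x u (Jstar α x v) = 0

/-- Quaternionic Kaehler-like condition: for every canonical basis `J` of `Λ` over an open set `U`
there are smooth 1-forms `η_1, η_2, η_3` on `U` with
`(∇_X J_α) Y = η_{α+2}(X) J_{α+1} Y - η_{α+1}(X) J_{α+2} Y`. -/
def IsKaehlerLike (S : StatisticalStructure I M)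
    (Λ : Π x : M, Submodule ℝ (TangentSpace I x →L[ℝ] TangentSpace I x)) : Prop :=
  ∀ U J, IsCanonicalBasisOn Λ U J →
    ∃ η : Fin 3 → Π x : M, TangentSpace I x →L[ℝ] ℝ,
      (∀ α, ContMDiffOn I (I.prod 𝓘(ℝ, E →L[ℝ] ℝ)) ∞
        (fun x ↦ TotalSpace.mk' (E →L[ℝ] ℝ)
          (E := fun x : M ↦ TangentSpace I x →L[ℝ] Bundle.Trivial M ℝ x) x (η α x)) U) ∧
      ∀ x ∈ U, ∀ α, ∀ (u : TangentSpace I x) (Y : Π y : M, TangentSpace I y),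
        MDiffAt (T% Y) x →
          S.conn (fun y ↦ J α y (Y y)) x u - J α x (S.conn Y x u)
            = η (α + 2) x u • J (α + 1) x (Y x) - η (α + 1) x u • J (α + 2) x (Y x)

/-- The curvature tensor of `∇` is
`R(X,Y)Z = c/4 {g(Y,Z)X - g(X,Z)Y + ∑_α [g(Z,J_αY)J_αX - g(Z,J_αX)J_αY]
  + ∑_α [g(X,J_αY)J_αZ - g(J_αX,Y)J_αZ]}` for canonical bases `J` of `Λ`. -/
def HasSpaceFormCurvature (S : StatisticalStructure I M)
    (Λ : Π x : M, Submodule ℝ (TangentSpace I x →L[ℝ] TangentSpace I x)) (c : ℝ) : Prop :=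
  ∀ U J, IsCanonicalBasisOn Λ U J → ∀ x ∈ U, ∀ X Y Z : TangentSpace I x,
    curvature S.conn x X Y Z = (c / 4) •
      (S.metric.inner x Y Z • X - S.metric.inner x X Z • Y
        + ∑ α, (S.metric.inner x Z (J α x Y) • J α x X - S.metric.inner x Z (J α x X) • J α x Y)
        + ∑ α, (S.metric.inner x X (J α x Y) • J α x Z - S.metric.inner x (J α x X) Y • J α x Z))

/-- A quaternionic Kaehler-like statistical manifold `(M, g, ∇, ∇*, Λ)` with curvature constant
`c`. -/
structure IsQuaternionKaehlerLike (S : StatisticalStructure I M)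
    (Λ : Π x : M, Submodule ℝ (TangentSpace I x →L[ℝ] TangentSpace I x)) (c : ℝ) : Prop where
  quaternionic : IsAlmostQuaternionic Λ
  hermiteLike : IsAlmostHermiteLike S Λ
  kaehlerLike : IsKaehlerLike S Λ
  curvature_eq : HasSpaceFormCurvature S Λ c

end Statistical

/-! ### Submanifolds -/

section Submanifold

variable {E : Type*} [NormedAddCommGroup E] [NormedSpace ℝ E]
  {H : Type*} [TopologicalSpace H] {I : ModelWithCorners ℝ E H}
  {M : Type*} [TopologicalSpace M] [ChartedSpace H M] [IsManifold I ∞ M]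
  {E' : Type*} [NormedAddCommGroup E'] [NormedSpace ℝ E']
  {H' : Type*} [TopologicalSpace H'] {I' : ModelWithCorners ℝ E' H'}
  {N : Type*} [TopologicalSpace N] [ChartedSpace H' N] [IsManifold I' ∞ N]

/-- The covariant derivative `∇̂_u V` at `p` of a vector field `V` along `f : M → N` in the
direction `u ∈ T_p M`, i.e. the pull-back to `f^* TN` of a connection `∇̂` on `N`. In the local
frame `(b_i)` of `TN` that is constant in the trivialization at `f p`, and with
`V = ∑ V_i · (b_i ∘ f)`, it is `∑ V_i(p) ∇̂_{df u} b_i + ∑ dV_i(u) b_i(f p)`. -/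
def covAlong (cov : CovariantDerivative I' E' (TangentSpace I' : N → Type _)) (f : M → N)
    (V : Π q : M, TangentSpace I' (f q)) (p : M) (u : TangentSpace I p) : TangentSpace I' (f p) :=
  cov (FiberBundle.extend E' (V p)) (f p) (mfderiv I I' f p u)
    + (trivializationAt E' (TangentSpace I' : N → Type _) (f p)).symm (f p)
        (mvfderiv I (fun q ↦ (trivializationAt E' (TangentSpace I' : N → Type _) (f p)
          (TotalSpace.mk' E' (f q) (V q))).2) p u)

/-- `∇` is the connection that `∇̂` induces on `M` through `f : M → N`: `df(∇_u Y)` is the tangential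
part of `∇̂_u (df Y)`, for all vector fields `Y` on `M`. -/
def IsInducedConnection (g : ContMDiffRiemannianMetric I' ∞ E' (TangentSpace I' : N → Type _))
    (cov' : CovariantDerivative I' E' (TangentSpace I' : N → Type _))
    (cov : CovariantDerivative I E (TangentSpace I : M → Type _)) (f : M → N) : Prop :=
  ∀ (p : M) (Y : Π q : M, TangentSpace I q), MDiffAt (T% Y) p → ∀ u w : TangentSpace I p,
    g.inner (f p) (covAlong cov' f (fun q ↦ mfderiv I I' f q (Y q)) p u) (mfderiv I I' f p w)
      = g.inner (f p) (mfderiv I I' f p (cov Y p u)) (mfderiv I I' f p w)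

/-- The second fundamental form, defined by Gauss' formula
`σ(u,v) = ∇̂_u (df Y) - df(∇_u Y)`, where `Y` is a vector field, smooth near `p`, with
`Y p = v` (for the induced connection `∇` the extension does not matter). -/
def secondFundamentalForm (cov' : CovariantDerivative I' E' (TangentSpace I' : N → Type _))
    (cov : CovariantDerivative I E (TangentSpace I : M → Type _)) (f : M → N)
    (p : M) (u v : TangentSpace I p) : TangentSpace I' (f p) :=
  covAlong cov' f (fun q ↦ mfderiv I I' f q (FiberBundle.extend E v q)) p u
    - mfderiv I I' f p (cov (FiberBundle.extend E v) p u)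

variable [FiniteDimensional ℝ E] [FiniteDimensional ℝ E']

/-- `(M, g, ∇, ∇*)` is a statistical submanifold of `(N, ĝ, ∇̂, ∇̂*)` through the immersion `f`:
`g`, `∇` and `∇*` are induced by `ĝ`, `∇̂` and `∇̂*`. -/
structure IsStatisticalSubmanifold (S : StatisticalStructure I M) (T : StatisticalStructure I' N)
    (f : M → N) : Prop where
  immersion : IsImmersion I I' ∞ f
  metric_eq : ∀ (p : M) (u v : TangentSpace I p),
    S.metric.inner p u v = T.metric.inner (f p) (mfderiv I I' f p u) (mfderiv I I' f p v)
  conn_induced : IsInducedConnection T.metric T.conn S.conn f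
  dualConn_induced : IsInducedConnection T.metric T.dualConn S.dualConn f

/-- Totally real: every element of `Λ` (equivalently, `J_1`, `J_2` and `J_3` for every canonical
basis of `Λ`) maps tangent vectors of `M` to normal vectors. -/
def IsTotallyReal (T : StatisticalStructure I' N)
    (Λ : Π x : N, Submodule ℝ (TangentSpace I' x →L[ℝ] TangentSpace I' x)) (f : M → N) : Prop :=
  ∀ (p : M), ∀ A ∈ Λ (f p), ∀ u v : TangentSpace I p,
    T.metric.inner (f p) (A (mfderiv I I' f p u)) (mfderiv I I' f p v) = 0

/-- The mean curvature vector `(1/n) ∑ σ(e_i, e_i)`, where `e_1, …, e_n` is an orthonormal basis of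
`T_p M`. -/
def meanCurvature (cov' : CovariantDerivative I' E' (TangentSpace I' : N → Type _))
    (cov : CovariantDerivative I E (TangentSpace I : M → Type _)) (f : M → N) {n : ℕ}
    (p : M) (e : Fin n → TangentSpace I p) : TangentSpace I' (f p) :=
  (1 / (n : ℝ)) • ∑ i, secondFundamentalForm cov' cov f p (e i) (e i)

/-- `K̂°(u ∧ v)`: the Riemannian sectional curvature of the ambient manifold on the tangent plane of
`M` with orthonormal basis `u, v`. -/
def ambientSectionalLC (T : StatisticalStructure I' N) (f : M → N) (p : M)
    (u v : TangentSpace I p) : ℝ :=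
  T.sectionalLC (f p) (mfderiv I I' f p u) (mfderiv I I' f p v)

/-- `τ̂° = ∑_{i < j} K̂°(e_i ∧ e_j)`, where `e_1, …, e_n` is an orthonormal basis of `T_p M`: the
Riemannian scalar curvature of the ambient manifold on the `n`-plane `T_p M`. -/
def ambientScalarLC (T : StatisticalStructure I' N) (f : M → N) {n : ℕ} (p : M)
    (e : Fin n → TangentSpace I p) : ℝ :=
  T.scalarLC (f p) (fun i ↦ mfderiv I I' f p (e i))

/-- `M` is minimal: the mean curvature vectors `H` of `∇` and `H*` of `∇*` both vanish at every
point. -/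
def IsMinimal (S : StatisticalStructure I M) (T : StatisticalStructure I' N) (f : M → N) : Prop :=
  ∀ (n : ℕ), n = Module.finrank ℝ E →
    ∀ (p : M) (e : Fin n → TangentSpace I p), S.IsOrthonormal p e →
      meanCurvature T.conn S.conn f p e = 0 ∧ meanCurvature T.dualConn S.dualConn f p e = 0

end Submanifold

end StatGeom

end

set_option linter.unusedSectionVars false

namespace StatGeom

/-! ### Calculus in charts -/

section Calculus

variable {E E' : Type*} [NormedAddCommGroup E] [NormedSpace ℝ E]
  [NormedAddCommGroup E'] [NormedSpace ℝ E']

/-! Split the second fundamental forms as σ° = (σ + σ*)/2 and δ = (σ - σ*)/2, and for a symmetric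
normal-valued form h put q_h(u,v) = ĝ(h(u,u), h(v,v)) - |h(u,v)|². Since σ = σ° + δ and σ* = σ° - δ,
the Gauss equation for ∇, averaged with its dual, contributes q_σ° - q_δ to K - K°. The term -2K°
contributes -2K̂° - 2q_σ° by the Gauss equation for ∇°. On a totally real submanifold the ambient
curvature of ∇̂ contributes c/4 on each orthonormal pair, so K - K° = c/4 - 2K̂° - q_δ - q_σ°. Both
quadratic terms now carry the same sign.

Minimality makes σ° and δ traceless. For a traceless h, twice the sum of q_h over all pairs of basis
vectors is minus the sum of |h(e_a,e_b)|² over all a, b. Keep only the entries belonging to the two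
planes and use 2ĝ(x,y) ≥ -|x|² - |y|²: the full sum is at most the sum of q_h over the two planes
(`sum_pairs_le_of_trace_eq_zero`). Applied to σ° and δ, this gives the inequality opposite to the
strict one assumed; the c-terms add up to (n(n-1)/2 - 2)·c/4.

The geometric input is `gauss_equation` together with the duality R ↔ R* (`inner_curvature_dual`).
Both are proved in charts: connections become Christoffel symbols, the metric becomes a family of
bilinear forms, and the identities follow by differentiating normality, respectively the metric, and
antisymmetrising. -/

/-- The curvature of the connection with Christoffel symbols `Γ` on an open subset of a vector
space. -/
noncomputable def chartCurvature (Γ : E → E →L[ℝ] E →L[ℝ] E) (y u v w : E) : E :=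
  fderiv ℝ Γ y u v w - fderiv ℝ Γ y v u w + Γ y u (Γ y v w) - Γ y v (Γ y u w)

/-- The second fundamental form of `F` with respect to connections with Christoffel symbols `Γ`
and `Γ'`. -/
noncomputable def chartSecondForm (Γ' : E' → E' →L[ℝ] E' →L[ℝ] E') (Γ : E → E →L[ℝ] E →L[ℝ] E) (F : E → E')
    (y v w : E) : E' :=
  fderiv ℝ (fderiv ℝ F) y v w + Γ' (F y) (fderiv ℝ F y v) (fderiv ℝ F y w)
    - fderiv ℝ F y (Γ y v w)

set_option synthInstance.maxHeartbeats 200000 in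
-- Differentiate the normality relation G(h(v,w), dF z) = 0 in the direction u and antisymmetrise in
-- u, v. The third derivatives of F cancel by symmetry, the derivatives of the Christoffel symbols
-- assemble into the two curvatures, and duality moves the derivative of G onto Γ' and Γs'.
theorem chart_gauss {F : E → E'} {y : E} (hF : ContDiffAt ℝ 3 F y)
    {Γ Γs : E → E →L[ℝ] E →L[ℝ] E} {Γ' Γs' : E' → E' →L[ℝ] E' →L[ℝ] E'}
    {G : E' → E' →L[ℝ] E' →L[ℝ] ℝ}
    (hΓ : DifferentiableAt ℝ Γ y) (hΓ' : DifferentiableAt ℝ Γ' (F y))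
    (hG : DifferentiableAt ℝ G (F y))
    (hdual : ∀ c a b, fderiv ℝ G (F y) c a b
      = G (F y) (Γ' (F y) c a) b + G (F y) a (Γs' (F y) c b))
    (hnormal : ∀ᶠ x in 𝓝 y, ∀ v w z,
      G (F x) (chartSecondForm Γ' Γ F x v w) (fderiv ℝ F x z) = 0)
    (u v w z : E) :
    G (F y) (chartCurvature Γ' (F y) (fderiv ℝ F y u) (fderiv ℝ F y v) (fderiv ℝ F y w))
        (fderiv ℝ F y z)
      = G (F y) (fderiv ℝ F y (chartCurvature Γ y u v w)) (fderiv ℝ F y z)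
        + G (F y) (chartSecondForm Γ' Γ F y u w) (chartSecondForm Γs' Γs F y v z)
        - G (F y) (chartSecondForm Γ' Γ F y v w) (chartSecondForm Γs' Γs F y u z) := by
  have hF1 : HasFDerivAt F (fderiv ℝ F y) y := (hF.differentiableAt (by norm_num)).hasFDerivAt
  have hc1 : ContDiffAt ℝ 2 (fderiv ℝ F) y := hF.fderiv_right (by norm_num)
  have hF2 : HasFDerivAt (fderiv ℝ F) (fderiv ℝ (fderiv ℝ F) y) y :=
    (hc1.differentiableAt (by norm_num)).hasFDerivAt
  have hc2 : ContDiffAt ℝ 1 (fderiv ℝ (fderiv ℝ F)) y := hc1.fderiv_right (by norm_num)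
  have hF3 : HasFDerivAt (fderiv ℝ (fderiv ℝ F)) (fderiv ℝ (fderiv ℝ (fderiv ℝ F)) y) y :=
    (hc2.differentiableAt (by norm_num)).hasFDerivAt
  have sym2 : ∀ a b, fderiv ℝ (fderiv ℝ F) y a b = fderiv ℝ (fderiv ℝ F) y b a :=
    fun a b ↦ (hF.isSymmSndFDerivAt (by simp; norm_num)) a b
  have sym3 : ∀ a b, fderiv ℝ (fderiv ℝ (fderiv ℝ F)) y a b
      = fderiv ℝ (fderiv ℝ (fderiv ℝ F)) y b a :=
    fun a b ↦ (hc1.isSymmSndFDerivAt (by simp)) a b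
  have hΓF := HasFDerivAt.comp (g := Γ') y hΓ'.hasFDerivAt hF1
  have hGF : HasFDerivAt (fun x ↦ G (F x)) ((fderiv ℝ G (F y)).comp (fderiv ℝ F y)) y :=
    HasFDerivAt.comp (g := G) (g' := fderiv ℝ G (F y)) y hG.hasFDerivAt hF1
  -- The u-derivative of the normality relation, quantified because it is needed again with u and v
  -- exchanged.
  have key : ∀ u v : E,
      G (F y) (Γ' (F y) (fderiv ℝ F y u) (chartSecondForm Γ' Γ F y v w)) (fderiv ℝ F y z)
      + G (F y) (chartSecondForm Γ' Γ F y v w) (Γs' (F y) (fderiv ℝ F y u) (fderiv ℝ F y z))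
      + G (F y) (fderiv ℝ (fderiv ℝ (fderiv ℝ F)) y u v w
          + (fderiv ℝ Γ' (F y) (fderiv ℝ F y u) (fderiv ℝ F y v) (fderiv ℝ F y w)
          + Γ' (F y) (fderiv ℝ (fderiv ℝ F) y u v) (fderiv ℝ F y w)
          + Γ' (F y) (fderiv ℝ F y v) (fderiv ℝ (fderiv ℝ F) y u w))
          - (fderiv ℝ (fderiv ℝ F) y u (Γ y v w) + fderiv ℝ F y (fderiv ℝ Γ y u v w)))
          (fderiv ℝ F y z)
      + G (F y) (chartSecondForm Γ' Γ F y v w) (fderiv ℝ (fderiv ℝ F) y u z) = 0 := by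
    intro u v
    have e1 := (hF3.clm_apply (hasFDerivAt_const v y)).clm_apply (hasFDerivAt_const w y)
    have e2 := (hΓF.clm_apply (hF2.clm_apply (hasFDerivAt_const v y))).clm_apply
      (hF2.clm_apply (hasFDerivAt_const w y))
    have e3 := hF2.clm_apply ((hΓ.hasFDerivAt.clm_apply (hasFDerivAt_const v y)).clm_apply
      (hasFDerivAt_const w y))
    have e4 := (hGF.clm_apply ((e1.add e2).sub e3)).clm_apply
      (hF2.clm_apply (hasFDerivAt_const z y))
    have e5 : HasFDerivAt (fun x ↦ G (F x) (chartSecondForm Γ' Γ F x v w) (fderiv ℝ F x z))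
        (0 : E →L[ℝ] ℝ) y :=
      (hasFDerivAt_const (0 : ℝ) y).congr_of_eventuallyEq (hnormal.mono fun x hx ↦ hx v w z)
    have e6 := congrArg (fun L ↦ L u) (e4.unique e5)
    simp only [add_apply, sub_apply,
      ContinuousLinearMap.comp_apply, ContinuousLinearMap.flip_apply,
      zero_apply, map_zero, zero_add, hdual, Pi.add_apply, Function.comp_apply,
      Pi.sub_apply] at e6
    change _ = _ at e6
    simp only [chartSecondForm, map_add, map_sub, add_apply,
      sub_apply] at e6 ⊢
    linarith
  have n0 := hnormal.self_of_nhds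
  have k1 := key u v
  have k2 := key v u
  -- `m1` and `m2` turn the terms with second derivatives along Γ(v,w) and Γ(u,w) into the quadratic
  -- part of the curvature. `m3` and `m4` say that h is orthogonal to the tangential vectors
  -- dF(Γs(·,z)), so subtracting these completes the dual second form at no cost.
  have m1 := n0 u (Γ y v w) z
  have m2 := n0 v (Γ y u w) z
  have m3 := n0 v w (Γs y u z)
  have m4 := n0 u w (Γs y v z)
  rw [sym3 v u, sym2 v u] at k2
  simp only [chartSecondForm, chartCurvature, map_add, map_sub, add_apply,
    sub_apply] at *
  linarith

set_option synthInstance.maxHeartbeats 200000 in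
-- Second derivatives of the function G(w,z) commute. Expanding them by duality, the mixed terms
-- G(Γw, Γs z) are symmetric in the two directions, and what remains is the curvature of Γ on w plus
-- that of Γs on z.
theorem chart_curvature_dual {y : E} {Γ Γs : E → E →L[ℝ] E →L[ℝ] E} {G : E → E →L[ℝ] E →L[ℝ] ℝ}
    (hΓ : DifferentiableAt ℝ Γ y) (hΓs : DifferentiableAt ℝ Γs y)
    (hG : ∀ᶠ x in 𝓝 y, DifferentiableAt ℝ G x)
    (hdual : ∀ᶠ x in 𝓝 y, ∀ c a b, fderiv ℝ G x c a b = G x (Γ x c a) b + G x a (Γs x c b))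
    (u v w z : E) :
    G y (chartCurvature Γ y u v w) z = - G y w (chartCurvature Γs y u v z) := by
  have hGy := hG.self_of_nhds.hasFDerivAt
  -- The derivative of G(w,z) as duality predicts it; it makes sense and is differentiable without
  -- assuming that G is twice differentiable.
  let A : E → E →L[ℝ] ℝ := fun x ↦
    (((ContinuousLinearMap.apply ℝ ℝ z).comp (G x)).comp ((Γ x).flip w))
      + (G x w).comp ((Γs x).flip z)
  have hA : ∀ᶠ x in 𝓝 y, HasFDerivAt (fun x ↦ G x w z) (A x) x := by
    filter_upwards [hG, hdual] with x h1 h2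
    refine ((h1.hasFDerivAt.clm_apply (hasFDerivAt_const w x)).clm_apply
      (hasFDerivAt_const z x)).congr_fderiv ?_
    ext c
    simp [A, h2]
  have hAd : DifferentiableAt ℝ A y := by
    have : DifferentiableAt ℝ G y := hG.self_of_nhds
    have f1 : DifferentiableAt ℝ (fun x ↦ (Γ x).flip) y :=
      ((ContinuousLinearMap.flipₗᵢ ℝ E E E).toContinuousLinearEquiv.differentiableAt).comp y hΓ
    have f2 : DifferentiableAt ℝ (fun x ↦ (Γs x).flip) y :=
      ((ContinuousLinearMap.flipₗᵢ ℝ E E E).toContinuousLinearEquiv.differentiableAt).comp y hΓs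
    exact (((differentiableAt_const _).clm_comp this).clm_comp
      (f1.clm_apply (differentiableAt_const _))).add
      ((this.clm_apply (differentiableAt_const _)).clm_comp
        (f2.clm_apply (differentiableAt_const _)))
  have sym := second_derivative_symmetric_of_eventually hA hAd.hasFDerivAt u v
  have val : ∀ u v, fderiv ℝ A y u v
      = G y (Γ y u (Γ y v w)) z + G y (Γ y v w) (Γs y u z) + G y (fderiv ℝ Γ y u v w) z
        + (G y (Γ y u w) (Γs y v z) + G y w (Γs y u (Γs y v z))
          + G y w (fderiv ℝ Γs y u v z)) := by
    intro u v
    have e0 := hAd.hasFDerivAt.clm_apply (hasFDerivAt_const v y)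
    have e1 := (hGy.clm_apply ((hΓ.hasFDerivAt.clm_apply (hasFDerivAt_const v y)).clm_apply
      (hasFDerivAt_const w y))).clm_apply (hasFDerivAt_const z y)
    have e2 := (hGy.clm_apply (hasFDerivAt_const w y)).clm_apply
      ((hΓs.hasFDerivAt.clm_apply (hasFDerivAt_const v y)).clm_apply (hasFDerivAt_const z y))
    have e3 := congrArg (fun L ↦ L u) (e0.unique (e1.add e2))
    simp only [add_apply, ContinuousLinearMap.comp_apply,
      ContinuousLinearMap.flip_apply, zero_apply, map_zero, zero_add,
      hdual.self_of_nhds] at e3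
    linarith
  rw [val, val] at sym
  simp only [chartCurvature, map_add, map_sub, add_apply,
    sub_apply]
  linarith

theorem differentiableAt_sum_sum_clm {A W ι : Type*} [NormedAddCommGroup A] [NormedSpace ℝ A]
    [NormedAddCommGroup W] [NormedSpace ℝ W] [Fintype ι] (T : ι → ι → A →L[ℝ] W)
    {g : ι → ι → E → A} {x : E} (hg : ∀ i j, DifferentiableAt ℝ (g i j) x) :
    DifferentiableAt ℝ (fun x ↦ ∑ i, ∑ j, T i j (g i j x)) x :=
  DifferentiableAt.fun_sum fun i _ ↦ DifferentiableAt.fun_sum fun j _ ↦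
    (T i j).differentiableAt.comp x (hg i j)

set_option synthInstance.maxHeartbeats 200000 in
/-- A family of maps that are bilinear near `y` and depend differentiably on the parameter is given
by a differentiable family of continuous bilinear maps. -/
theorem exists_clm₂_of_differentiableAt [FiniteDimensional ℝ E] {y : E} {f : E → E → E → E'}
    (hadd₁ : ∀ᶠ x in 𝓝 y, ∀ a a' b, f x (a + a') b = f x a b + f x a' b)
    (hsmul₁ : ∀ᶠ x in 𝓝 y, ∀ (r : ℝ) (a b), f x (r • a) b = r • f x a b)
    (hadd₂ : ∀ᶠ x in 𝓝 y, ∀ a b b', f x a (b + b') = f x a b + f x a b')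
    (hsmul₂ : ∀ᶠ x in 𝓝 y, ∀ (r : ℝ) (a b), f x a (r • b) = r • f x a b)
    (hf : ∀ᶠ x in 𝓝 y, ∀ a b, DifferentiableAt ℝ (fun x ↦ f x a b) x) :
    ∃ B : E → E →L[ℝ] E →L[ℝ] E', (∀ᶠ x in 𝓝 y, DifferentiableAt ℝ B x) ∧
      ∀ᶠ x in 𝓝 y, ∀ a b, B x a b = f x a b := by
  let bs := Module.finBasis ℝ E
  let co := fun i ↦ (bs.coord i).toContinuousLinearMap
  obtain ⟨T, hT⟩ : ∃ T : Fin (Module.finrank ℝ E) → Fin (Module.finrank ℝ E) →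
      E' →L[ℝ] E →L[ℝ] E →L[ℝ] E', ∀ i j e a b, T i j e a b = co i a • co j b • e :=
    ⟨fun i j ↦ (ContinuousLinearMap.smulRightL ℝ E (E →L[ℝ] E') (co i)).comp
      (ContinuousLinearMap.smulRightL ℝ E E' (co j)), fun i j e a b ↦ by simp⟩
  refine ⟨fun x ↦ ∑ i, ∑ j, T i j (f x (bs i) (bs j)), ?_, ?_⟩
  · filter_upwards [hf] with x hf
    have h := @differentiableAt_sum_sum_clm E _ _ E' (E →L[ℝ] E →L[ℝ] E') _ _ _ _ _ _ T
      (fun i j x ↦ f x (bs i) (bs j)) x (fun i j ↦ hf (bs i) (bs j))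
    exact h
  · filter_upwards [hadd₁, hsmul₁, hadd₂, hsmul₂] with x h1 h2 h3 h4 a b
    let L : E →ₗ[ℝ] E →ₗ[ℝ] E' := LinearMap.mk₂ ℝ (f x) h1 h2 h3 h4
    have hL : f x a b = L (∑ i, bs.repr a i • bs i) (∑ j, bs.repr b j • bs j) := by
      rw [bs.sum_repr, bs.sum_repr]; rfl
    rw [hL]
    simp only [map_sum, LinearMap.sum_apply, map_smul, LinearMap.smul_apply, sum_apply,
      Finset.smul_sum]
    rw [Finset.sum_comm]
    simp [L, co, hT, smul_comm (bs.repr b _)]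

end Calculus

/-! ### An algebraic inequality for traceless symmetric families -/

section Algebra

theorem sum_comp_fin_four_le {n : ℕ} {i : Fin 4 → Fin n} (hi : Function.Injective i)
    {r : Fin n → ℝ} (hr : ∀ a, 0 ≤ r a) :
    r (i 0) + r (i 1) + r (i 2) + r (i 3) ≤ ∑ a, r a := by
  have h := Finset.sum_le_sum_of_subset_of_nonneg (f := r)
    (Finset.subset_univ (Finset.univ.map ⟨i, hi⟩)) (fun a _ _ ↦ hr a)
  simpa [Fin.sum_univ_four] using h

/-- Squaring the trace condition turns twice the sum over pairs into minus the sum of all squared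
entries. Discarding squares outside the two chosen blocks only increases it, and in each block the
inequality reduces to |A₀₀ + A₁₁|² ≥ 0. Only positive semidefiniteness of `B` enters. -/
theorem sum_pairs_le_of_trace_eq_zero {V : Type*} [AddCommGroup V] [Module ℝ V]
    (B : V →ₗ[ℝ] V →ₗ[ℝ] ℝ) (hsymm : ∀ v w, B v w = B w v) (hpos : ∀ v, 0 ≤ B v v)
    {n : ℕ} (A : Fin n → Fin n → V) (hA : ∀ a b, A a b = A b a) (htr : ∑ a, A a a = 0)
    (i : Fin 4 → Fin n) (hi : Function.Injective i) :
    ∑ a, ∑ b ∈ Finset.Ioi a, (B (A a a) (A b b) - B (A a b) (A a b))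
      ≤ (B (A (i 0) (i 0)) (A (i 1) (i 1)) - B (A (i 0) (i 1)) (A (i 0) (i 1)))
        + (B (A (i 2) (i 2)) (A (i 3) (i 3)) - B (A (i 2) (i 3)) (A (i 2) (i 3))) := by
  set q : Fin n → Fin n → ℝ := fun a b ↦ B (A a a) (A b b) - B (A a b) (A a b) with hq
  have h1 : 2 * ∑ a, ∑ b ∈ Finset.Ioi a, q a b = ∑ a, ∑ b ∈ {a}ᶜ, q b a := by
    rw [← Finset.sum_sum_Ioi_add_eq_sum_sum_off_diag, Finset.mul_sum]
    refine Finset.sum_congr rfl fun a _ ↦ ?_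
    rw [Finset.mul_sum]
    refine Finset.sum_congr rfl fun b _ ↦ ?_
    simp only [hq]
    rw [hsymm (A b b), hA b a]
    ring
  have h2 : ∑ a, ∑ b ∈ {a}ᶜ, q b a
      = - ∑ a, B (A a a) (A a a) - ∑ a, ∑ b ∈ {a}ᶜ, B (A b a) (A b a) := by
    have h3 : ∀ a, ∑ b ∈ ({a}ᶜ : Finset (Fin n)), B (A b b) (A a a) = - B (A a a) (A a a) := by
      intro a
      have h := Finset.sum_compl_add_sum ({a} : Finset (Fin n)) (fun b ↦ B (A b b) (A a a))
      have h0 : ∑ b, B (A b b) (A a a) = 0 := by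
        rw [← LinearMap.sum_apply, ← map_sum, htr]
        simp
      rw [h0, Finset.sum_singleton] at h
      linarith
    simp only [hq, Finset.sum_sub_distrib, h3, Finset.sum_neg_distrib]
  have h4 := sum_comp_fin_four_le hi (r := fun a ↦ B (A a a) (A a a)) (fun a ↦ hpos _)
  -- Off-diagonal squares are grouped by column: the four selected columns contain each of the two
  -- in-plane entries twice, once on each side of the diagonal.
  have h5 := sum_comp_fin_four_le hi (r := fun a ↦ ∑ b ∈ {a}ᶜ, B (A b a) (A b a))
    (fun a ↦ Finset.sum_nonneg fun b _ ↦ hpos _)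
  have h6 : ∀ a b, a ≠ b → B (A a b) (A a b) ≤ ∑ c ∈ {b}ᶜ, B (A c b) (A c b) := fun a b hab ↦
    Finset.single_le_sum (f := fun c ↦ B (A c b) (A c b)) (fun c _ ↦ hpos _) (by simpa using hab)
  have n01 := h6 (i 0) (i 1) (hi.ne (by decide))
  have n10 := h6 (i 1) (i 0) (hi.ne (by decide))
  have n23 := h6 (i 2) (i 3) (hi.ne (by decide))
  have n32 := h6 (i 3) (i 2) (hi.ne (by decide))
  rw [hA (i 1) (i 0)] at n10
  rw [hA (i 3) (i 2)] at n32
  -- This trades the two diagonal squares of a block for the cross term 2B(A₀₀, A₁₁).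
  have p01 := hpos (A (i 0) (i 0) + A (i 1) (i 1))
  have p23 := hpos (A (i 2) (i 2) + A (i 3) (i 3))
  simp only [map_add, LinearMap.add_apply] at p01 p23
  rw [hsymm (A (i 1) (i 1)) (A (i 0) (i 0))] at p01
  rw [hsymm (A (i 3) (i 3)) (A (i 2) (i 2))] at p23
  simp only [hq] at h1 h2 ⊢
  linarith

end Algebra

/-! ### Vector fields and connections in charts -/

section Charts

variable {E : Type*} [NormedAddCommGroup E] [NormedSpace ℝ E]
  {M : Type*} [TopologicalSpace M] [ChartedSpace E M] [IsManifold 𝓘(ℝ, E) ∞ M]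

/-- The components of a tangent vector in the chart at `x₀`. -/
noncomputable def chartCoord (x₀ x : M) : TangentSpace 𝓘(ℝ, E) x →L[ℝ] E :=
  (trivializationAt E (TangentSpace 𝓘(ℝ, E)) x₀).continuousLinearMapAt ℝ x

/-- The vector field with constant components `a` in the chart at `x₀`. -/
noncomputable def chartField (x₀ : M) (a : E) (x : M) : TangentSpace 𝓘(ℝ, E) x :=
  (trivializationAt E (TangentSpace 𝓘(ℝ, E)) x₀).symm x a

theorem chartField_eq_symmL {x₀ x : M} (hx : x ∈ (chartAt E x₀).source) (a : E) :
    chartField x₀ a x = (trivializationAt E (TangentSpace 𝓘(ℝ, E)) x₀).symmL ℝ x a :=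
  ((trivializationAt E (TangentSpace 𝓘(ℝ, E)) x₀).symmL_apply hx a).symm

theorem chartCoord_chartField {x₀ x : M} (hx : x ∈ (chartAt E x₀).source) (a : E) :
    chartCoord x₀ x (chartField x₀ a x) = a := by
  rw [chartField_eq_symmL hx]
  exact (trivializationAt E (TangentSpace 𝓘(ℝ, E)) x₀).continuousLinearMapAt_symmL hx a

theorem chartField_chartCoord {x₀ x : M} (hx : x ∈ (chartAt E x₀).source)
    (v : TangentSpace 𝓘(ℝ, E) x) : chartField x₀ (chartCoord x₀ x v) x = v := by
  rw [chartField_eq_symmL hx]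
  exact (trivializationAt E (TangentSpace 𝓘(ℝ, E)) x₀).symmL_continuousLinearMapAt hx v

theorem chartCoord_eq_snd {x₀ x : M} (hx : x ∈ (chartAt E x₀).source)
    (v : TangentSpace 𝓘(ℝ, E) x) :
    chartCoord x₀ x v = (trivializationAt E (TangentSpace 𝓘(ℝ, E)) x₀ ⟨x, v⟩).2 :=
  (trivializationAt E (TangentSpace 𝓘(ℝ, E)) x₀).continuousLinearMapAt_apply_of_mem ℝ hx v

theorem extend_eq_chartField {x₀ : M} (v : TangentSpace 𝓘(ℝ, E) x₀) :
    FiberBundle.extend E v = chartField x₀ (chartCoord x₀ x₀ v) := by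
  funext x
  rw [chartCoord_eq_snd (mem_chart_source E x₀)]
  rfl

theorem contMDiffAt_chartField {x₀ x : M} (hx : x ∈ (chartAt E x₀).source) (a : E) :
    ContMDiffAt 𝓘(ℝ, E) (𝓘(ℝ, E).prod 𝓘(ℝ, E)) ∞ (T% (chartField x₀ a)) x := by
  rw [(trivializationAt E (TangentSpace 𝓘(ℝ, E)) x₀).contMDiffAt_section_iff hx]
  refine (contMDiffAt_const (c := a)).congr_of_eventuallyEq ?_
  filter_upwards [(chartAt E x₀).open_source.mem_nhds hx] with y hy
  rw [← chartCoord_eq_snd hy, chartCoord_chartField hy]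

end Charts

/-! ### Derivatives, brackets and covariant derivatives of vector fields in a chart -/

section Charts

variable {E : Type*} [NormedAddCommGroup E] [NormedSpace ℝ E]
  {M : Type*} [TopologicalSpace M] [ChartedSpace E M] [IsManifold 𝓘(ℝ, E) ∞ M]

theorem mdifferentiableAt_chartField {x₀ x : M} (hx : x ∈ (chartAt E x₀).source) (a : E) :
    MDiffAt (T% (chartField x₀ a)) x :=
  (contMDiffAt_chartField hx a).mdifferentiableAt (by simp)

theorem contMDiffAt_chartCoord {x₀ x : M} (hx : x ∈ (chartAt E x₀).source)
    {V : Π y : M, TangentSpace 𝓘(ℝ, E) y} {k : ℕ∞ω} (hk : k ≤ ∞)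
    (hV : ContMDiffAt 𝓘(ℝ, E) (𝓘(ℝ, E).prod 𝓘(ℝ, E)) k (T% V) x) :
    ContMDiffAt 𝓘(ℝ, E) 𝓘(ℝ, E) k (fun y ↦ chartCoord x₀ y (V y)) x := by
  have : ContMDiffVectorBundle k E (TangentSpace 𝓘(ℝ, E) : M → Type _) 𝓘(ℝ, E) :=
    ContMDiffVectorBundle.of_le hk
  refine (((trivializationAt E (TangentSpace 𝓘(ℝ, E)) x₀).contMDiffAt_section_iff hx).1
    hV).congr_of_eventuallyEq ?_
  filter_upwards [(chartAt E x₀).open_source.mem_nhds hx] with y hy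
  exact chartCoord_eq_snd hy _

theorem mdifferentiableAt_chartCoord_iff {x₀ x : M} (hx : x ∈ (chartAt E x₀).source)
    {V : Π y : M, TangentSpace 𝓘(ℝ, E) y} :
    MDiffAt (fun y ↦ chartCoord x₀ y (V y)) x ↔ MDiffAt (T% V) x := by
  have h := (trivializationAt E (TangentSpace 𝓘(ℝ, E)) x₀).mdifferentiableAt_section_iff
    𝓘(ℝ, E) V hx
  rw [h]
  refine Filter.EventuallyEq.mdifferentiableAt_iff ?_
  filter_upwards [(chartAt E x₀).open_source.mem_nhds hx] with y hy
  exact chartCoord_eq_snd hy _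

theorem chartCoord_eq_mfderiv {x₀ x : M} (hx : x ∈ (chartAt E x₀).source) :
    chartCoord x₀ x = mfderiv 𝓘(ℝ, E) 𝓘(ℝ, E) (extChartAt 𝓘(ℝ, E) x₀) x :=
  TangentBundle.continuousLinearMapAt_trivializationAt hx

theorem contDiffAt_comp_symm {G : Type*} [NormedAddCommGroup G] [NormedSpace ℝ G] {x₀ x : M}
    {k : ℕ∞ω} (hk : k ≤ ∞)
    (hx : x ∈ (chartAt E x₀).source) {h : M → G} (hh : ContMDiffAt 𝓘(ℝ, E) 𝓘(ℝ, G) k h x) :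
    ContDiffAt ℝ k (h ∘ (extChartAt 𝓘(ℝ, E) x₀).symm) (extChartAt 𝓘(ℝ, E) x₀ x) := by
  have hx' : x ∈ (extChartAt 𝓘(ℝ, E) x₀).source := by rwa [extChartAt_source]
  have hφ : ContMDiffAt 𝓘(ℝ, E) 𝓘(ℝ, E) k (extChartAt 𝓘(ℝ, E) x₀).symm
      (extChartAt 𝓘(ℝ, E) x₀ x) :=
    ((contMDiffOn_extChartAt_symm x₀).contMDiffAt
      (extChartAt_target_mem_nhds' ((extChartAt 𝓘(ℝ, E) x₀).map_source hx'))).of_le hk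
  rw [← contMDiffAt_iff_contDiffAt]
  refine ContMDiffAt.comp _ ?_ hφ
  rwa [(extChartAt 𝓘(ℝ, E) x₀).left_inv hx']

theorem mdifferentiableAt_extChartAt_symm {x₀ x : M} (hx : x ∈ (chartAt E x₀).source) :
    MDifferentiableAt 𝓘(ℝ, E) 𝓘(ℝ, E) (extChartAt 𝓘(ℝ, E) x₀).symm
      (extChartAt 𝓘(ℝ, E) x₀ x) := by
  have hx' : x ∈ (extChartAt 𝓘(ℝ, E) x₀).source := by rwa [extChartAt_source]
  exact ((contMDiffOn_extChartAt_symm (n := ∞) x₀).contMDiffAt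
    (extChartAt_target_mem_nhds' ((extChartAt 𝓘(ℝ, E) x₀).map_source hx'))).mdifferentiableAt
      (by simp)

theorem differentiableAt_comp_symm {G : Type*} [NormedAddCommGroup G] [NormedSpace ℝ G] {x₀ x : M}
    (hx : x ∈ (chartAt E x₀).source) {h : M → G} (hh : MDiffAt h x) :
    DifferentiableAt ℝ (h ∘ (extChartAt 𝓘(ℝ, E) x₀).symm) (extChartAt 𝓘(ℝ, E) x₀ x) := by
  have hx' : x ∈ (extChartAt 𝓘(ℝ, E) x₀).source := by rwa [extChartAt_source]
  rw [← mdifferentiableAt_iff_differentiableAt]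
  refine MDifferentiableAt.comp _ ?_ (mdifferentiableAt_extChartAt_symm hx)
  rwa [(extChartAt 𝓘(ℝ, E) x₀).left_inv hx']

theorem mvfderiv_apply_congr {G : Type*} [NormedAddCommGroup G] [NormedSpace ℝ G] {x : M}
    {h h' : M → G} (hh : h =ᶠ[𝓝 x] h') (v : TangentSpace 𝓘(ℝ, E) x) :
    mvfderiv 𝓘(ℝ, E) h x v = mvfderiv 𝓘(ℝ, E) h' x v :=
  congrArg (fun L : TangentSpace 𝓘(ℝ, E) x →L[ℝ] TangentSpace 𝓘(ℝ, G) (h x) ↦ L v) hh.mfderiv_eq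

/-- The derivative of a function, in the chart at `x₀`. -/
theorem mvfderiv_eq_fderiv {G : Type*} [NormedAddCommGroup G] [NormedSpace ℝ G] {x₀ x : M}
    (hx : x ∈ (chartAt E x₀).source) {h : M → G} (hh : MDiffAt h x)
    (v : TangentSpace 𝓘(ℝ, E) x) :
    mvfderiv 𝓘(ℝ, E) h x v
      = fderiv ℝ (h ∘ (extChartAt 𝓘(ℝ, E) x₀).symm) (extChartAt 𝓘(ℝ, E) x₀ x)
        (chartCoord x₀ x v) := by
  have hx' : x ∈ (extChartAt 𝓘(ℝ, E) x₀).source := by rwa [extChartAt_source]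
  have e1 : h =ᶠ[𝓝 x] (h ∘ (extChartAt 𝓘(ℝ, E) x₀).symm) ∘ extChartAt 𝓘(ℝ, E) x₀ := by
    filter_upwards [extChartAt_source_mem_nhds' hx'] with y hy
    rw [Function.comp_apply, Function.comp_apply, (extChartAt 𝓘(ℝ, E) x₀).left_inv hy]
  have e2 := mvfderiv_apply_congr e1 v
  have e3 := mfderiv_comp_apply x
    ((mdifferentiableAt_iff_differentiableAt).2 (differentiableAt_comp_symm hx hh))
    (mdifferentiableAt_extChartAt (I := 𝓘(ℝ, E)) hx) v
  rw [mfderiv_eq_fderiv, ← chartCoord_eq_mfderiv hx] at e3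
  exact e2.trans e3

variable [FiniteDimensional ℝ E]

/-- The extensions have constant components in the chart at `x`, that is, they are combinations of
commuting coordinate fields. This removes the bracket term from both curvature and torsion. -/
theorem mlieBracket_extend (x : M) (u v : TangentSpace 𝓘(ℝ, E) x) :
    VectorField.mlieBracket 𝓘(ℝ, E) (FiberBundle.extend E u) (FiberBundle.extend E v) x = 0 := by
  have key (a : E) : VectorField.mpullbackWithin 𝓘(ℝ, E) 𝓘(ℝ, E) (extChartAt 𝓘(ℝ, E) x).symm
      (chartField x a) (Set.range 𝓘(ℝ, E))
        =ᶠ[𝓝[(extChartAt 𝓘(ℝ, E) x).symm ⁻¹' Set.univ ∩ Set.range 𝓘(ℝ, E)]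
          (extChartAt 𝓘(ℝ, E) x x)] (fun _ ↦ a : E → E) := by
    refine Filter.Eventually.filter_mono nhdsWithin_le_nhds ?_
    filter_upwards [extChartAt_target_mem_nhds (I := 𝓘(ℝ, E)) x] with y hy
    have hs : (extChartAt 𝓘(ℝ, E) x).symm y ∈ (chartAt E x).source := by
      rw [← extChartAt_source 𝓘(ℝ, E)]
      exact (extChartAt 𝓘(ℝ, E) x).map_target hy
    have h1 := TangentBundle.symmL_trivializationAt (I := 𝓘(ℝ, E)) hs
    rw [(extChartAt 𝓘(ℝ, E) x).right_inv hy] at h1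
    have h2 := isInvertible_mfderivWithin_extChartAt_symm (I := 𝓘(ℝ, E)) hy
    rw [VectorField.mpullbackWithin_apply, chartField_eq_symmL hs, h1]
    exact h2.inverse_apply_eq.2 rfl
  rw [extend_eq_chartField, extend_eq_chartField, ← VectorField.mlieBracketWithin_univ,
    VectorField.mlieBracketWithin_apply]
  have h0 : VectorField.lieBracketWithin ℝ (fun _ : E ↦ chartCoord x x u)
      (fun _ : E ↦ chartCoord x x v)
      ((extChartAt 𝓘(ℝ, E) x).symm ⁻¹' Set.univ ∩ Set.range 𝓘(ℝ, E))
      (extChartAt 𝓘(ℝ, E) x x) = 0 := by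
    simp [VectorField.lieBracketWithin]
  rw [Filter.EventuallyEq.lieBracketWithin_vectorField_eq_of_mem (key _) (key _) (by simp)]
  exact (congrArg (mfderiv 𝓘(ℝ, E) 𝓘(ℝ, E) (extChartAt 𝓘(ℝ, E) x) x).inverse h0).trans
    (map_zero _)

/-- The difference between the connection and the flat derivative of components is tensorial, so it
depends only on the value of `V` at `x`; evaluate it on the field with constant components and the
same value. -/
theorem cov_eq_chartField (cov : CovariantDerivative 𝓘(ℝ, E) E (TangentSpace 𝓘(ℝ, E) : M → Type _))
    {x₀ x : M} (hx : x ∈ (chartAt E x₀).source) {V : Π y : M, TangentSpace 𝓘(ℝ, E) y}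
    (hV : MDiffAt (T% V) x) (u : TangentSpace 𝓘(ℝ, E) x) :
    cov V x u = chartField x₀ (mvfderiv 𝓘(ℝ, E) (fun y ↦ chartCoord x₀ y (V y)) x u) x
      + cov (chartField x₀ (chartCoord x₀ x (V x))) x u := by
  let Φ : (Π y : M, TangentSpace 𝓘(ℝ, E) y) → TangentSpace 𝓘(ℝ, E) x := fun V ↦
    cov V x u - (trivializationAt E (TangentSpace 𝓘(ℝ, E)) x₀).symmL ℝ x
      (mvfderiv 𝓘(ℝ, E) (fun y ↦ chartCoord x₀ y (V y)) x u)
  have hΦ : TensorialAt 𝓘(ℝ, E) E Φ x := by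
    constructor
    · intro f σ hf hσ
      have hσ' := (mdifferentiableAt_chartCoord_iff hx).2 hσ
      have h1 : (fun y ↦ chartCoord x₀ y ((f • σ) y)) = f • fun y ↦ chartCoord x₀ y (σ y) := by
        funext y; simp
      have h2 : (trivializationAt E (TangentSpace 𝓘(ℝ, E)) x₀).symmL ℝ x (chartCoord x₀ x (σ x))
          = σ x := by
        rw [← chartField_eq_symmL hx, chartField_chartCoord hx]
      simp only [Φ]
      rw [cov.isCovariantDerivativeOnUniv.leibniz hσ hf, h1, mvfderiv_smul hf hσ']
      simp only [add_apply, smul_apply, ContinuousLinearMap.smulRight_apply, map_add, map_smul, h2]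
      module
    · intro σ σ' hσ hσ'
      have h1 : (fun y ↦ chartCoord x₀ y ((σ + σ') y))
          = (fun y ↦ chartCoord x₀ y (σ y)) + fun y ↦ chartCoord x₀ y (σ' y) := by
        funext y; simp
      simp only [Φ]
      rw [cov.isCovariantDerivativeOnUniv.add hσ hσ', h1,
        mvfderiv_add ((mdifferentiableAt_chartCoord_iff hx).2 hσ)
          ((mdifferentiableAt_chartCoord_iff hx).2 hσ')]
      simp only [add_apply, map_add]
      module
  have h := hΦ.pointwise hV (mdifferentiableAt_chartField hx (chartCoord x₀ x (V x)))
    (chartField_chartCoord hx _).symm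
  have h0 : mvfderiv 𝓘(ℝ, E)
      (fun y ↦ chartCoord x₀ y (chartField x₀ (chartCoord x₀ x (V x)) y)) x u = 0 := by
    have : (fun y ↦ chartCoord x₀ y (chartField x₀ (chartCoord x₀ x (V x)) y))
        =ᶠ[𝓝 x] fun _ ↦ chartCoord x₀ x (V x) := by
      filter_upwards [(chartAt E x₀).open_source.mem_nhds hx] with y hy
      exact chartCoord_chartField hy _
    rw [mvfderiv_apply_congr this, mvfderiv_const]
    rfl
  simp only [Φ, h0, map_zero, sub_zero] at h
  rw [chartField_eq_symmL hx, ← h]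
  abel

/-- Smoothness of the connection is applied to globally smooth fields, while chart fields are smooth
only on the chart domain. A bump function equal to 1 near `x` makes them global, and locality of the
connection removes it again. -/
theorem contMDiffAt_cov_chartField [T2Space M]
    {cov : CovariantDerivative 𝓘(ℝ, E) E (TangentSpace 𝓘(ℝ, E) : M → Type _)}
    (hcov : CovariantDerivative.ContMDiffCovariantDerivative cov ∞)
    {x₀ x : M} (hx : x ∈ (chartAt E x₀).source) (a b : E) :
    ContMDiffAt 𝓘(ℝ, E) 𝓘(ℝ, E) ∞
      (fun y ↦ chartCoord x₀ y (cov (chartField x₀ b) y (chartField x₀ a y))) x := by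
  obtain ⟨ψ, -, hψ⟩ := (SmoothBumpFunction.nhds_basis_tsupport (I := 𝓘(ℝ, E)) x).mem_iff.1
    ((chartAt E x₀).open_source.mem_nhds hx)
  have h1 : ContMDiff 𝓘(ℝ, E) (𝓘(ℝ, E).prod 𝓘(ℝ, E)) ∞
      (T% ((ψ : M → ℝ) • chartField x₀ b)) :=
    ContMDiffOn.smul_section_of_tsupport ψ.contMDiff.contMDiffOn (chartAt E x₀).open_source hψ
      (fun y hy ↦ (contMDiffAt_chartField hy b).contMDiffWithinAt)
  have h2 := (hcov.contMDiff.contMDiff (h1.contMDiffOn (s := Set.univ))).contMDiffAt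
    (Filter.univ_mem (f := 𝓝 x))
  have h3 := contMDiffAt_chartCoord hx le_rfl
    (h2.clm_bundle_apply (contMDiffAt_chartField hx a))
  refine h3.congr_of_eventuallyEq ?_
  filter_upwards [(chartAt E x₀).open_source.mem_nhds hx,
    ψ.eventuallyEq_one.eventually_nhds] with y hy hy1
  have h4 : MDiffAt (T% ((ψ : M → ℝ) • chartField x₀ b)) y :=
    (h1 y).mdifferentiableAt (by simp)
  rw [cov.isCovariantDerivativeOnUniv.congr_of_eventuallyEq (mdifferentiableAt_chartField hy b) h4
    Filter.univ_mem]
  filter_upwards [hy1] with z hz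
  simp [hz]

end Charts

/-! ### Christoffel symbols and metric coefficients -/

section Christoffel

variable {E : Type*} [NormedAddCommGroup E] [NormedSpace ℝ E]
  {M : Type*} [TopologicalSpace M] [ChartedSpace E M] [IsManifold 𝓘(ℝ, E) ∞ M]

theorem eventually_chart_source (x₀ : M) : ∀ᶠ x in 𝓝 x₀, x ∈ (chartAt E x₀).source :=
  (chartAt E x₀).open_source.mem_nhds (mem_chart_source E x₀)

theorem eventually_extChartAt_symm {x₀ : M} {p : M → Prop} (h : ∀ᶠ x in 𝓝 x₀, p x) :
    ∀ᶠ y in 𝓝 (extChartAt 𝓘(ℝ, E) x₀ x₀), p ((extChartAt 𝓘(ℝ, E) x₀).symm y) := by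
  have hc := continuousAt_extChartAt_symm (I := 𝓘(ℝ, E)) x₀
  refine hc.eventually ?_
  rwa [extChartAt_to_inv]

theorem eventually_extChartAt_right_inv (x₀ : M) :
    ∀ᶠ y in 𝓝 (extChartAt 𝓘(ℝ, E) x₀ x₀),
      extChartAt 𝓘(ℝ, E) x₀ ((extChartAt 𝓘(ℝ, E) x₀).symm y) = y := by
  filter_upwards [extChartAt_target_mem_nhds (I := 𝓘(ℝ, E)) x₀] with y hy
  exact (extChartAt 𝓘(ℝ, E) x₀).right_inv hy

theorem eventually_extChartAt_symm_mem_source (x₀ : M) :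
    ∀ᶠ y in 𝓝 (extChartAt 𝓘(ℝ, E) x₀ x₀),
      (extChartAt 𝓘(ℝ, E) x₀).symm y ∈ (chartAt E x₀).source :=
  eventually_extChartAt_symm (eventually_chart_source x₀)

theorem chartField_add {x₀ x : M} (hx : x ∈ (chartAt E x₀).source) (a b : E) :
    chartField x₀ (a + b) x = chartField x₀ a x + chartField x₀ b x := by
  simp only [chartField_eq_symmL hx, map_add]

theorem chartField_smul {x₀ x : M} (hx : x ∈ (chartAt E x₀).source) (r : ℝ) (a : E) :
    chartField x₀ (r • a) x = r • chartField x₀ a x := by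
  simp only [chartField_eq_symmL hx, map_smul]

/-- `Γ` represents the connection `cov` in the chart at `x₀`, near `x₀`. -/
structure IsChristoffelAt (cov : CovariantDerivative 𝓘(ℝ, E) E (TangentSpace 𝓘(ℝ, E) : M → Type _))
    (x₀ : M) (Γ : E → E →L[ℝ] E →L[ℝ] E) : Prop where
  differentiableAt : DifferentiableAt ℝ Γ (extChartAt 𝓘(ℝ, E) x₀ x₀)
  eventually_eq : ∀ᶠ x in 𝓝 x₀, ∀ V : Π y : M, TangentSpace 𝓘(ℝ, E) y, MDiffAt (T% V) x →
    ∀ u : TangentSpace 𝓘(ℝ, E) x, chartCoord x₀ x (cov V x u)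
      = mvfderiv 𝓘(ℝ, E) (fun y ↦ chartCoord x₀ y (V y)) x u
        + Γ (extChartAt 𝓘(ℝ, E) x₀ x) (chartCoord x₀ x u) (chartCoord x₀ x (V x))

/-- `G` represents the Riemannian metric `g` in the chart at `x₀`, near `x₀`. -/
structure IsMetricAt (g : ContMDiffRiemannianMetric 𝓘(ℝ, E) ∞ E (TangentSpace 𝓘(ℝ, E) : M → Type _))
    (x₀ : M) (G : E → E →L[ℝ] E →L[ℝ] ℝ) : Prop where
  eventually_differentiableAt : ∀ᶠ y in 𝓝 (extChartAt 𝓘(ℝ, E) x₀ x₀), DifferentiableAt ℝ G y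
  eventually_eq : ∀ᶠ x in 𝓝 x₀, ∀ v w : TangentSpace 𝓘(ℝ, E) x,
    g.inner x v w = G (extChartAt 𝓘(ℝ, E) x₀ x) (chartCoord x₀ x v) (chartCoord x₀ x w)

theorem mvfderiv_chartCoord_chartField {x₀ x : M} (hx : x ∈ (chartAt E x₀).source) (a : E)
    (u : TangentSpace 𝓘(ℝ, E) x) :
    mvfderiv 𝓘(ℝ, E) (fun y ↦ chartCoord x₀ y (chartField x₀ a y)) x u = 0 := by
  have : (fun y ↦ chartCoord x₀ y (chartField x₀ a y)) =ᶠ[𝓝 x] fun _ ↦ a := by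
    filter_upwards [(chartAt E x₀).open_source.mem_nhds hx] with y hy
    exact chartCoord_chartField hy _
  rw [mvfderiv_apply_congr this, mvfderiv_const]
  rfl

theorem IsChristoffelAt.eventually_chartField
    {cov : CovariantDerivative 𝓘(ℝ, E) E (TangentSpace 𝓘(ℝ, E) : M → Type _)}
    {x₀ : M} {Γ : E → E →L[ℝ] E →L[ℝ] E} (h : IsChristoffelAt cov x₀ Γ) :
    ∀ᶠ x in 𝓝 x₀, ∀ (a : E) (u : TangentSpace 𝓘(ℝ, E) x),
      chartCoord x₀ x (cov (chartField x₀ a) x u)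
        = Γ (extChartAt 𝓘(ℝ, E) x₀ x) (chartCoord x₀ x u) a := by
  filter_upwards [h.eventually_eq, eventually_chart_source (E := E) x₀] with x hx hx' a u
  rw [hx _ (mdifferentiableAt_chartField hx' a), mvfderiv_chartCoord_chartField hx', zero_add,
    chartCoord_chartField hx']

variable [FiniteDimensional ℝ E]

theorem exists_isMetricAt
    (g : ContMDiffRiemannianMetric 𝓘(ℝ, E) ∞ E (TangentSpace 𝓘(ℝ, E) : M → Type _)) (x₀ : M) :
    ∃ G, IsMetricAt g x₀ G := by
  let φ := extChartAt 𝓘(ℝ, E) x₀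
  let f : E → E → E → ℝ := fun y a b ↦
    g.inner (φ.symm y) (chartField x₀ a (φ.symm y)) (chartField x₀ b (φ.symm y))
  have hs := eventually_extChartAt_symm_mem_source (E := E) x₀
  obtain ⟨G, hG, hGf⟩ := exists_clm₂_of_differentiableAt (f := f) (y := φ x₀)
    (hs.mono fun y hy a a' b ↦ by simp only [f]; rw [chartField_add hy, map_add, add_apply])
    (hs.mono fun y hy r a b ↦ by simp only [f]; rw [chartField_smul hy, map_smul, smul_apply])
    (hs.mono fun y hy a b b' ↦ by simp only [f]; rw [chartField_add hy, map_add])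
    (hs.mono fun y hy r a b ↦ by simp only [f]; rw [chartField_smul hy, map_smul])
    (by
      filter_upwards [hs, eventually_extChartAt_right_inv (E := E) x₀] with y hy hy' a b
      have h1 : ContMDiffAt 𝓘(ℝ, E) 𝓘(ℝ) ∞
          (fun x ↦ g.inner x (chartField x₀ a x) (chartField x₀ b x)) (φ.symm y) := by
        have h2 := (g.contMDiff (φ.symm y)).clm_bundle_apply₂
          (E₃ := Bundle.Trivial M ℝ) (contMDiffAt_chartField hy a) (contMDiffAt_chartField hy b)
        exact (contMDiffAt_section _).1 h2
      have h3 := (contDiffAt_comp_symm le_rfl hy h1).differentiableAt (by simp)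
      rwa [hy'] at h3)
  refine ⟨G, hG, ?_⟩
  have hc := (continuousAt_extChartAt (I := 𝓘(ℝ, E)) x₀).eventually hGf
  filter_upwards [hc, eventually_chart_source (E := E) x₀] with x hx hx' v w
  have hx'' : x ∈ φ.source := by rwa [extChartAt_source]
  rw [hx]
  simp only [f]
  rw [φ.left_inv hx'', chartField_chartCoord hx', chartField_chartCoord hx']

theorem exists_isChristoffelAt [T2Space M]
    {cov : CovariantDerivative 𝓘(ℝ, E) E (TangentSpace 𝓘(ℝ, E) : M → Type _)}
    (hcov : CovariantDerivative.ContMDiffCovariantDerivative cov ∞) (x₀ : M) :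
    ∃ Γ, IsChristoffelAt cov x₀ Γ := by
  let φ := extChartAt 𝓘(ℝ, E) x₀
  let f : E → E → E → E := fun y a b ↦
    chartCoord x₀ (φ.symm y) (cov (chartField x₀ b) (φ.symm y) (chartField x₀ a (φ.symm y)))
  have hs := eventually_extChartAt_symm_mem_source (E := E) x₀
  have hadd {x : M} (hx : x ∈ (chartAt E x₀).source) (b b' : E) :
      cov (chartField x₀ (b + b')) x = cov (chartField x₀ b) x + cov (chartField x₀ b') x := by
    have m1 := mdifferentiableAt_chartField hx b
    have m2 := mdifferentiableAt_chartField hx b'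
    rw [← cov.isCovariantDerivativeOnUniv.add m1 m2]
    refine cov.isCovariantDerivativeOnUniv.congr_of_eventuallyEq
      (mdifferentiableAt_chartField hx _) (mdifferentiableAt_add_section m1 m2)
      Filter.univ_mem ?_
    filter_upwards [(chartAt E x₀).open_source.mem_nhds hx] with y hy
    exact chartField_add hy b b'
  have hsmul {x : M} (hx : x ∈ (chartAt E x₀).source) (r : ℝ) (b : E) :
      cov (chartField x₀ (r • b)) x = r • cov (chartField x₀ b) x := by
    have m1 := mdifferentiableAt_chartField hx b
    rw [← cov.isCovariantDerivativeOnUniv.smul_const r m1]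
    refine cov.isCovariantDerivativeOnUniv.congr_of_eventuallyEq
      (mdifferentiableAt_chartField hx _) (m1.smul_const_section)
      Filter.univ_mem ?_
    filter_upwards [(chartAt E x₀).open_source.mem_nhds hx] with y hy
    exact chartField_smul hy r b
  obtain ⟨Γ, hΓ, hΓf⟩ := exists_clm₂_of_differentiableAt (f := f) (y := φ x₀)
    (hs.mono fun y hy a a' b ↦ by simp only [f]; rw [chartField_add hy, map_add, map_add])
    (hs.mono fun y hy r a b ↦ by simp only [f]; rw [chartField_smul hy, map_smul, map_smul])
    (hs.mono fun y hy a b b' ↦ by simp only [f]; rw [hadd hy, add_apply, map_add])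
    (hs.mono fun y hy r a b ↦ by simp only [f]; rw [hsmul hy, smul_apply, map_smul])
    (by
      filter_upwards [hs, eventually_extChartAt_right_inv (E := E) x₀] with y hy hy' a b
      have h3 := (contDiffAt_comp_symm le_rfl hy
        (contMDiffAt_cov_chartField hcov hy a b)).differentiableAt (by simp)
      rwa [hy'] at h3)
  refine ⟨Γ, hΓ.self_of_nhds, ?_⟩
  have hc := (continuousAt_extChartAt (I := 𝓘(ℝ, E)) x₀).eventually hΓf
  filter_upwards [hc, eventually_chart_source (E := E) x₀] with x hx hx' V hV u
  have hx'' : x ∈ φ.source := by rwa [extChartAt_source]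
  rw [hx, cov_eq_chartField cov hx' hV, map_add, chartCoord_chartField hx']
  simp only [f]
  rw [φ.left_inv hx'', chartField_chartCoord hx']

/-- On fields with constant components the bracket vanishes, so torsion is the antisymmetric part of
Γ. -/
theorem IsChristoffelAt.symm
    {cov : CovariantDerivative 𝓘(ℝ, E) E (TangentSpace 𝓘(ℝ, E) : M → Type _)}
    (htor : cov.torsion = 0) {x₀ : M} {Γ : E → E →L[ℝ] E →L[ℝ] E}
    (h : IsChristoffelAt cov x₀ Γ) (u v : TangentSpace 𝓘(ℝ, E) x₀) :
    Γ (extChartAt 𝓘(ℝ, E) x₀ x₀) (chartCoord x₀ x₀ u) (chartCoord x₀ x₀ v)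
      = Γ (extChartAt 𝓘(ℝ, E) x₀ x₀) (chartCoord x₀ x₀ v) (chartCoord x₀ x₀ u) := by
  have h0 := h.eventually_chartField.self_of_nhds
  have h1 := cov.torsion_apply_eq_extend u v
  rw [htor, mlieBracket_extend, FiberBundle.extend_apply_self, FiberBundle.extend_apply_self,
    extend_eq_chartField, extend_eq_chartField, sub_zero] at h1
  have h2 := congrArg (chartCoord x₀ x₀) h1
  rw [map_sub, h0, h0] at h2
  simp only [Pi.zero_apply, zero_apply, map_zero] at h2
  exact sub_eq_zero.1 h2.symm

set_option synthInstance.maxHeartbeats 200000 in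
-- For constant-component fields ∇_b c has components Γ(b,c), so a second covariant derivative
-- yields one derivative of Γ and one product of Γ's.
theorem IsChristoffelAt.chartCoord_curvature
    {cov : CovariantDerivative 𝓘(ℝ, E) E (TangentSpace 𝓘(ℝ, E) : M → Type _)}
    {x₀ : M} {Γ : E → E →L[ℝ] E →L[ℝ] E}
    (h : IsChristoffelAt cov x₀ Γ) (u v w : TangentSpace 𝓘(ℝ, E) x₀) :
    chartCoord x₀ x₀ (curvature cov x₀ u v w) = chartCurvature Γ (extChartAt 𝓘(ℝ, E) x₀ x₀)
      (chartCoord x₀ x₀ u) (chartCoord x₀ x₀ v) (chartCoord x₀ x₀ w) := by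
  have hx := mem_chart_source E x₀
  have key (b c : E) (u : TangentSpace 𝓘(ℝ, E) x₀) :
      chartCoord x₀ x₀ (cov (fun y ↦ cov (chartField x₀ c) y (chartField x₀ b y)) x₀ u)
        = fderiv ℝ Γ (extChartAt 𝓘(ℝ, E) x₀ x₀) (chartCoord x₀ x₀ u) b c
          + Γ (extChartAt 𝓘(ℝ, E) x₀ x₀) (chartCoord x₀ x₀ u)
            (Γ (extChartAt 𝓘(ℝ, E) x₀ x₀) b c) := by
    have e1 : (fun y ↦ chartCoord x₀ y (cov (chartField x₀ c) y (chartField x₀ b y)))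
        =ᶠ[𝓝 x₀] fun y ↦ Γ (extChartAt 𝓘(ℝ, E) x₀ y) b c := by
      filter_upwards [h.eventually_chartField, eventually_chart_source (E := E) x₀] with y hy hy'
      rw [hy, chartCoord_chartField hy']
    have hd := (h.differentiableAt.hasFDerivAt.clm_apply (hasFDerivAt_const b _)).clm_apply
      (hasFDerivAt_const c _)
    have e2 : MDiffAt (fun y ↦ Γ (extChartAt 𝓘(ℝ, E) x₀ y) b c) x₀ :=
      MDifferentiableAt.comp (g := fun y ↦ Γ y b c) x₀
        (mdifferentiableAt_iff_differentiableAt.2 hd.differentiableAt)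
        (mdifferentiableAt_extChartAt hx)
    -- The inner field must be differentiable before the Christoffel formula applies to it; this is
    -- read off from its components.
    have e3 : MDiffAt (T% (fun y ↦ cov (chartField x₀ c) y (chartField x₀ b y))) x₀ :=
      (mdifferentiableAt_chartCoord_iff hx).1 (e2.congr_of_eventuallyEq e1)
    have e4 : ((fun y ↦ Γ (extChartAt 𝓘(ℝ, E) x₀ y) b c) ∘ (extChartAt 𝓘(ℝ, E) x₀).symm)
        =ᶠ[𝓝 (extChartAt 𝓘(ℝ, E) x₀ x₀)] fun y ↦ Γ y b c := by
      filter_upwards [eventually_extChartAt_right_inv (E := E) x₀] with y hy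
      simp only [Function.comp_apply, hy]
    rw [h.eventually_eq.self_of_nhds _ e3, mvfderiv_apply_congr e1, mvfderiv_eq_fderiv hx e2,
      e4.fderiv_eq, hd.fderiv,
      h.eventually_chartField.self_of_nhds, chartCoord_chartField hx]
    simp
  unfold curvature curvatureField
  rw [mlieBracket_extend, map_zero, sub_zero, map_sub, FiberBundle.extend_apply_self,
    FiberBundle.extend_apply_self, extend_eq_chartField, extend_eq_chartField,
    extend_eq_chartField, key, key, chartCurvature]
  abel

/-- Duality evaluated on fields with constant components. It holds at all points near the centre of
the chart because the curvature duality differentiates it once more. -/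
theorem IsMetricAt.fderiv_eq
    {g : ContMDiffRiemannianMetric 𝓘(ℝ, E) ∞ E (TangentSpace 𝓘(ℝ, E) : M → Type _)}
    {cov covs : CovariantDerivative 𝓘(ℝ, E) E (TangentSpace 𝓘(ℝ, E) : M → Type _)}
    (hdual : ∀ (x : M) (X Y Z : Π y : M, TangentSpace 𝓘(ℝ, E) y),
      MDiffAt (T% X) x → MDiffAt (T% Y) x → MDiffAt (T% Z) x →
        mvfderiv 𝓘(ℝ, E) (fun y ↦ g.inner y (Y y) (Z y)) x (X x)
          = g.inner x (cov Y x (X x)) (Z x) + g.inner x (Y x) (covs Z x (X x)))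
    {x₀ : M} {Γ Γs : E → E →L[ℝ] E →L[ℝ] E} {G : E → E →L[ℝ] E →L[ℝ] ℝ}
    (hG : IsMetricAt g x₀ G) (hΓ : IsChristoffelAt cov x₀ Γ) (hΓs : IsChristoffelAt covs x₀ Γs) :
    ∀ᶠ y in 𝓝 (extChartAt 𝓘(ℝ, E) x₀ x₀), ∀ c a b,
      fderiv ℝ G y c a b = G y (Γ y c a) b + G y a (Γs y c b) := by
  filter_upwards [eventually_extChartAt_right_inv (E := E) x₀,
    (eventually_extChartAt_right_inv (E := E) x₀).eventually_nhds,
    (eventually_extChartAt_symm_mem_source (E := E) x₀).eventually_nhds,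
    eventually_extChartAt_symm hΓ.eventually_chartField,
    eventually_extChartAt_symm hΓs.eventually_chartField,
    eventually_extChartAt_symm hG.eventually_eq,
    eventually_extChartAt_symm hG.eventually_eq.eventually_nhds,
    hG.eventually_differentiableAt] with y hr hr' hs' h1 h2 h3 h3' hd c a b
  have hs := hs'.self_of_nhds
  set x := (extChartAt 𝓘(ℝ, E) x₀).symm y with hxdef
  have hdd := (hd.hasFDerivAt.clm_apply (hasFDerivAt_const a _)).clm_apply
      (hasFDerivAt_const b _)
  have e0 := hdual x _ _ _ (mdifferentiableAt_chartField hs c) (mdifferentiableAt_chartField hs a)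
    (mdifferentiableAt_chartField hs b)
  rw [h3, h3, h1, h2, hr, chartCoord_chartField hs, chartCoord_chartField hs,
    chartCoord_chartField hs] at e0
  have e1 : (fun z ↦ g.inner z (chartField x₀ a z) (chartField x₀ b z))
      =ᶠ[𝓝 x] fun z ↦ G (extChartAt 𝓘(ℝ, E) x₀ z) a b := by
    filter_upwards [h3', (chartAt E x₀).open_source.mem_nhds hs] with z hz hz'
    rw [hz, chartCoord_chartField hz', chartCoord_chartField hz']
  have e2 : MDiffAt (fun z ↦ G (extChartAt 𝓘(ℝ, E) x₀ z) a b) x := by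
    refine MDifferentiableAt.comp (g := fun y ↦ G y a b) x
        (mdifferentiableAt_iff_differentiableAt.2 ?_)
        (mdifferentiableAt_extChartAt hs)
    rw [hr]
    exact hdd.differentiableAt
  have e4 : ((fun z ↦ G (extChartAt 𝓘(ℝ, E) x₀ z) a b) ∘ (extChartAt 𝓘(ℝ, E) x₀).symm)
      =ᶠ[𝓝 y] fun y ↦ G y a b := by
    filter_upwards [hr'] with z hz
    simp only [Function.comp_apply, hz]
  rw [mvfderiv_apply_congr e1, mvfderiv_eq_fderiv hs e2, hr, e4.fderiv_eq, hdd.fderiv,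
    chartCoord_chartField hs] at e0
  rw [← e0]
  simp

end Christoffel

/-! ### Covariant derivatives along maps -/

section AlongMaps

variable {E : Type*} [NormedAddCommGroup E] [NormedSpace ℝ E]
  {M : Type*} [TopologicalSpace M] [ChartedSpace E M] [IsManifold 𝓘(ℝ, E) ∞ M]

theorem mvfderiv_clm_apply {G G' : Type*} [NormedAddCommGroup G] [NormedSpace ℝ G]
    [NormedAddCommGroup G'] [NormedSpace ℝ G'] {A : M → G →L[ℝ] G'} {b : M → G} {x : M}
    (hA : MDiffAt A x) (hb : MDiffAt b x) (v : TangentSpace 𝓘(ℝ, E) x) :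
    mvfderiv 𝓘(ℝ, E) (fun y ↦ A y (b y)) x v
      = A x (mvfderiv 𝓘(ℝ, E) b x v) + mvfderiv 𝓘(ℝ, E) A x v (b x) := by
  have hx := mem_chart_source E x
  have hAb : MDiffAt (fun y ↦ A y (b y)) x := hA.clm_apply hb
  have h1 := (differentiableAt_comp_symm hx hA).hasFDerivAt.clm_apply
    (differentiableAt_comp_symm hx hb).hasFDerivAt
  rw [mvfderiv_eq_fderiv hx hAb, mvfderiv_eq_fderiv hx hA, mvfderiv_eq_fderiv hx hb]
  have h2 : (fun y ↦ A y (b y)) ∘ (extChartAt 𝓘(ℝ, E) x).symm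
      = fun y ↦ (A ∘ (extChartAt 𝓘(ℝ, E) x).symm) y ((b ∘ (extChartAt 𝓘(ℝ, E) x).symm) y) := rfl
  rw [h2, h1.fderiv]
  simp

variable {E' : Type*} [NormedAddCommGroup E'] [NormedSpace ℝ E']
  {N : Type*} [TopologicalSpace N] [ChartedSpace E' N] [IsManifold 𝓘(ℝ, E') ∞ N]

/-- Independence of the frame: `covAlong` at `q` uses the chart at `f q`, whereas differentiating in
`q` requires one fixed chart at `x₁`. The derivative of the transition map appears with opposite
signs in the derivative of the components and in the change of frame, and cancels. -/
theorem chartCoord_covAlong [FiniteDimensional ℝ E']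
    (cov : CovariantDerivative 𝓘(ℝ, E') E' (TangentSpace 𝓘(ℝ, E') : N → Type _))
    {f : M → N} {q : M} (hf : MDifferentiableAt 𝓘(ℝ, E) 𝓘(ℝ, E') f q) {x₁ : N}
    (hx : f q ∈ (chartAt E' x₁).source) {V : Π r : M, TangentSpace 𝓘(ℝ, E') (f r)}
    (hV : MDifferentiableAt 𝓘(ℝ, E) 𝓘(ℝ, E') (fun r ↦ chartCoord x₁ (f r) (V r)) q)
    (u : TangentSpace 𝓘(ℝ, E) q) :
    chartCoord x₁ (f q) (covAlong cov f V q u)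
      = mvfderiv 𝓘(ℝ, E) (fun r ↦ chartCoord x₁ (f r) (V r)) q u
        + chartCoord x₁ (f q) (cov (chartField x₁ (chartCoord x₁ (f q) (V q))) (f q)
          (mfderiv 𝓘(ℝ, E) 𝓘(ℝ, E') f q u)) := by
  have hy := mem_chart_source E' (f q)
  -- The transition from components at `x₁` to components at `f q`.
  let T : N → E' →L[ℝ] E' := fun y ↦ ((trivializationAt E' (TangentSpace 𝓘(ℝ, E')) x₁).coordChangeL ℝ
    (trivializationAt E' (TangentSpace 𝓘(ℝ, E')) (f q)) y : E' →L[ℝ] E')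
  have hT : MDifferentiableAt 𝓘(ℝ, E') 𝓘(ℝ, E' →L[ℝ] E') T (f q) :=
    mdifferentiableAt_coordChangeL hx hy
  have hTapp {y : N} (h1 : y ∈ (chartAt E' x₁).source) (h2 : y ∈ (chartAt E' (f q)).source)
      (a : E') : T y a = chartCoord (f q) y (chartField x₁ a y) := by
    rw [chartCoord_eq_snd h2]
    exact Trivialization.coordChangeL_apply _ _ ⟨h1, h2⟩ a
  have hTf : MDifferentiableAt 𝓘(ℝ, E) 𝓘(ℝ, E' →L[ℝ] E') (T ∘ f) q := hT.comp q hf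
  have n1 := (chartAt E' x₁).open_source.mem_nhds hx
  have n2 := (chartAt E' (f q)).open_source.mem_nhds hy
  have d2 : mvfderiv 𝓘(ℝ, E) (fun r ↦ (trivializationAt E' (TangentSpace 𝓘(ℝ, E') : N → Type _)
      (f q) (TotalSpace.mk' E' (f r) (V r))).2) q u
      = T (f q) (mvfderiv 𝓘(ℝ, E) (fun r ↦ chartCoord x₁ (f r) (V r)) q u)
        + mvfderiv 𝓘(ℝ, E') T (f q) (mfderiv 𝓘(ℝ, E) 𝓘(ℝ, E') f q u)
          (chartCoord x₁ (f q) (V q)) := by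
    have e1 : (fun r ↦ (trivializationAt E' (TangentSpace 𝓘(ℝ, E') : N → Type _)
        (f q) (TotalSpace.mk' E' (f r) (V r))).2)
        =ᶠ[𝓝 q] fun r ↦ (T ∘ f) r (chartCoord x₁ (f r) (V r)) := by
      filter_upwards [hf.continuousAt.eventually n1, hf.continuousAt.eventually n2] with r h1 h2
      rw [Function.comp_apply, hTapp h1 h2, chartField_chartCoord h1, chartCoord_eq_snd h2]
    rw [mvfderiv_apply_congr e1, mvfderiv_clm_apply hTf hV]
    have e2 : mvfderiv 𝓘(ℝ, E) (T ∘ f) q u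
      = mvfderiv 𝓘(ℝ, E') T (f q) (mfderiv 𝓘(ℝ, E) 𝓘(ℝ, E') f q u) :=
      mfderiv_comp_apply q hT hf u
    rw [e2]
    rfl
  have d1 (w : TangentSpace 𝓘(ℝ, E') (f q)) (a : E') :
      mvfderiv 𝓘(ℝ, E') (fun y ↦ chartCoord (f q) y (chartField x₁ a y)) (f q) w
        = mvfderiv 𝓘(ℝ, E') T (f q) w a := by
    have e1 : (fun y ↦ chartCoord (f q) y (chartField x₁ a y)) =ᶠ[𝓝 (f q)] fun y ↦ T y a := by
      filter_upwards [n1, n2] with y h1 h2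
      rw [hTapp h1 h2]
    rw [mvfderiv_apply_congr e1, mvfderiv_clm_apply hT mdifferentiableAt_const, mvfderiv_const]
    simp
  have e := cov_eq_chartField cov hy
    (mdifferentiableAt_chartField hx (chartCoord x₁ (f q) (V q)))
    (mfderiv 𝓘(ℝ, E) 𝓘(ℝ, E') f q u)
  rw [d1, chartField_chartCoord hx] at e
  rw [covAlong, d2, extend_eq_chartField, e]
  change chartCoord x₁ (f q) (_ + chartField (f q) (_ + _) (f q)) = _
  rw [chartField_add hy, hTapp hx hy, chartField_chartCoord hy]
  simp only [map_add, chartCoord_chartField hx]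
  abel

/-- The expression of `f` in the charts at `p` and `f p`. -/
noncomputable def inCharts (f : M → N) (p : M) : E → E' :=
  extChartAt 𝓘(ℝ, E') (f p) ∘ f ∘ (extChartAt 𝓘(ℝ, E) p).symm

end AlongMaps

/-! ### The Gauss equation -/

section InCharts

variable {E : Type*} [NormedAddCommGroup E] [NormedSpace ℝ E]
  {M : Type*} [TopologicalSpace M] [ChartedSpace E M] [IsManifold 𝓘(ℝ, E) ∞ M]
  {E' : Type*} [NormedAddCommGroup E'] [NormedSpace ℝ E']
  {N : Type*} [TopologicalSpace N] [ChartedSpace E' N] [IsManifold 𝓘(ℝ, E') ∞ N]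

theorem inCharts_extChartAt (f : M → N) {p q : M} (hq : q ∈ (chartAt E p).source) :
    inCharts f p (extChartAt 𝓘(ℝ, E) p q) = extChartAt 𝓘(ℝ, E') (f p) (f q) := by
  have hq' : q ∈ (extChartAt 𝓘(ℝ, E) p).source := by rwa [extChartAt_source]
  simp only [inCharts, Function.comp_apply, (extChartAt 𝓘(ℝ, E) p).left_inv hq']

theorem contDiffAt_inCharts {f : M → N} {p q : M}
    (hf : ContMDiffAt 𝓘(ℝ, E) 𝓘(ℝ, E') ∞ f q) (hq : q ∈ (chartAt E p).source)
    (hfq : f q ∈ (chartAt E' (f p)).source) :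
    ContDiffAt ℝ ∞ (inCharts f p : E → E') (extChartAt 𝓘(ℝ, E) p q) :=
  contDiffAt_comp_symm le_rfl hq
    ((contMDiffAt_extChartAt' (I := 𝓘(ℝ, E')) (n := ∞) hfq).comp q hf)

theorem chartCoord_mfderiv {f : M → N} {p q : M}
    (hf : MDifferentiableAt 𝓘(ℝ, E) 𝓘(ℝ, E') f q) (hq : q ∈ (chartAt E p).source)
    (hfq : f q ∈ (chartAt E' (f p)).source) (u : TangentSpace 𝓘(ℝ, E) q) :
    chartCoord (f p) (f q) (mfderiv 𝓘(ℝ, E) 𝓘(ℝ, E') f q u)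
      = fderiv ℝ (inCharts f p) (extChartAt 𝓘(ℝ, E) p q) (chartCoord p q u) := by
  have h1 := mdifferentiableAt_extChartAt (I := 𝓘(ℝ, E')) hfq
  have h2 := mfderiv_comp_apply q h1 hf u
  rw [chartCoord_eq_mfderiv hfq]
  exact h2.symm.trans (mvfderiv_eq_fderiv hq (h1.comp q hf) u)

variable [FiniteDimensional ℝ E']

/-- The Gauss formula is evaluated on fields from the single chart at `p`, even at nearby points
`q`; this gives an identity on a neighbourhood, so that normality can later be differentiated. -/
theorem eventually_chartCoord_secondForm {f : M → N} (hf : ContMDiff 𝓘(ℝ, E) 𝓘(ℝ, E') ∞ f)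
    {p : M} {cov' : CovariantDerivative 𝓘(ℝ, E') E' (TangentSpace 𝓘(ℝ, E') : N → Type _)}
    {cov : CovariantDerivative 𝓘(ℝ, E) E (TangentSpace 𝓘(ℝ, E) : M → Type _)}
    {Γ : E → E →L[ℝ] E →L[ℝ] E} {Γ' : E' → E' →L[ℝ] E' →L[ℝ] E'}
    (hΓ : IsChristoffelAt cov p Γ) (hΓ' : IsChristoffelAt cov' (f p) Γ') :
    ∀ᶠ q in 𝓝 p, ∀ (a : E) (u : TangentSpace 𝓘(ℝ, E) q),
      chartCoord (f p) (f q)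
        (covAlong cov' f (fun r ↦ mfderiv 𝓘(ℝ, E) 𝓘(ℝ, E') f r (chartField p a r)) q u
          - mfderiv 𝓘(ℝ, E) 𝓘(ℝ, E') f q (cov (chartField p a) q u))
        = chartSecondForm Γ' Γ (inCharts f p) (extChartAt 𝓘(ℝ, E) p q) (chartCoord p q u) a := by
  have hs := hf.continuous.continuousAt.eventually (eventually_chart_source (E := E') (f p))
  filter_upwards [eventually_chart_source (E := E) p, hs, hs.eventually_nhds,
    hΓ.eventually_chartField, hf.continuous.continuousAt.eventually hΓ'.eventually_chartField]
    with q hq hfq hfq' h1 h2 a u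
  have hd := (hf q).mdifferentiableAt (by simp)
  have hF := contDiffAt_inCharts (hf q) hq hfq
  have hF2 : DifferentiableAt ℝ (fderiv ℝ (inCharts f p)) (extChartAt 𝓘(ℝ, E) p q) :=
    (hF.fderiv_right (m := 1) (by norm_cast)).differentiableAt (by simp)
  have hF3 := hF2.hasFDerivAt.clm_apply (hasFDerivAt_const a _)
  have e1 : (fun r ↦ chartCoord (f p) (f r) (mfderiv 𝓘(ℝ, E) 𝓘(ℝ, E') f r (chartField p a r)))
      =ᶠ[𝓝 q] fun r ↦ fderiv ℝ (inCharts f p) (extChartAt 𝓘(ℝ, E) p r) a := by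
    filter_upwards [(chartAt E p).open_source.mem_nhds hq, hfq'] with r hr hr'
    rw [chartCoord_mfderiv ((hf r).mdifferentiableAt (by simp)) hr hr', chartCoord_chartField hr]
  have e2 : MDiffAt (fun r ↦ fderiv ℝ (inCharts f p : E → E') (extChartAt 𝓘(ℝ, E) p r) a) q :=
    MDifferentiableAt.comp (g := fun y ↦ fderiv ℝ (inCharts f p : E → E') y a) q
      (mdifferentiableAt_iff_differentiableAt.2 hF3.differentiableAt)
      (mdifferentiableAt_extChartAt hq)
  have e3 : ((fun r ↦ fderiv ℝ (inCharts f p : E → E') (extChartAt 𝓘(ℝ, E) p r) a)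
      ∘ (extChartAt 𝓘(ℝ, E) p).symm) =ᶠ[𝓝 (extChartAt 𝓘(ℝ, E) p q)]
      fun y ↦ fderiv ℝ (inCharts f p) y a := by
    have hq' : q ∈ (extChartAt 𝓘(ℝ, E) p).source := by rwa [extChartAt_source]
    filter_upwards [extChartAt_target_mem_nhds' ((extChartAt 𝓘(ℝ, E) p).map_source hq')] with y hy
    simp only [Function.comp_apply, (extChartAt 𝓘(ℝ, E) p).right_inv hy]
  rw [map_sub, chartCoord_covAlong cov' hd hfq (e2.congr_of_eventuallyEq e1),
    mvfderiv_apply_congr e1, mvfderiv_eq_fderiv hq e2, e3.fderiv_eq, hF3.fderiv, h2,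
    chartCoord_mfderiv hd hq hfq, chartCoord_mfderiv hd hq hfq, chartCoord_mfderiv hd hq hfq, h1,
    chartCoord_chartField hq, ← inCharts_extChartAt f hq, chartSecondForm]
  simp

theorem chartCoord_secondFundamentalForm {f : M → N} (hf : ContMDiff 𝓘(ℝ, E) 𝓘(ℝ, E') ∞ f)
    {p : M} {cov' : CovariantDerivative 𝓘(ℝ, E') E' (TangentSpace 𝓘(ℝ, E') : N → Type _)}
    {cov : CovariantDerivative 𝓘(ℝ, E) E (TangentSpace 𝓘(ℝ, E) : M → Type _)}
    {Γ : E → E →L[ℝ] E →L[ℝ] E} {Γ' : E' → E' →L[ℝ] E' →L[ℝ] E'}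
    (hΓ : IsChristoffelAt cov p Γ) (hΓ' : IsChristoffelAt cov' (f p) Γ')
    (u v : TangentSpace 𝓘(ℝ, E) p) :
    chartCoord (f p) (f p) (secondFundamentalForm cov' cov f p u v)
      = chartSecondForm Γ' Γ (inCharts f p) (extChartAt 𝓘(ℝ, E) p p) (chartCoord p p u)
        (chartCoord p p v) := by
  rw [secondFundamentalForm, extend_eq_chartField]
  exact (eventually_chartCoord_secondForm hf hΓ hΓ').self_of_nhds _ u

/-- In charts it is D²F plus Christoffel terms: D²F is symmetric, and so are both Christoffel
symbols when the torsions vanish. -/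
theorem secondFundamentalForm_symm [FiniteDimensional ℝ E] [T2Space M] [T2Space N]
    {f : M → N} (hf : ContMDiff 𝓘(ℝ, E) 𝓘(ℝ, E') ∞ f)
    {cov' : CovariantDerivative 𝓘(ℝ, E') E' (TangentSpace 𝓘(ℝ, E') : N → Type _)}
    {cov : CovariantDerivative 𝓘(ℝ, E) E (TangentSpace 𝓘(ℝ, E) : M → Type _)}
    (hcov' : CovariantDerivative.ContMDiffCovariantDerivative cov' ∞)
    (hcov : CovariantDerivative.ContMDiffCovariantDerivative cov ∞)
    (htor' : cov'.torsion = 0) (htor : cov.torsion = 0)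
    (p : M) (u v : TangentSpace 𝓘(ℝ, E) p) :
    secondFundamentalForm cov' cov f p u v = secondFundamentalForm cov' cov f p v u := by
  obtain ⟨Γ, hΓ⟩ := exists_isChristoffelAt hcov p
  obtain ⟨Γ', hΓ'⟩ := exists_isChristoffelAt hcov' (f p)
  have hp := mem_chart_source E p
  have hfp := mem_chart_source E' (f p)
  have hd := (hf p).mdifferentiableAt (by simp)
  rw [← chartField_chartCoord hfp (secondFundamentalForm cov' cov f p u v),
    ← chartField_chartCoord hfp (secondFundamentalForm cov' cov f p v u),
    chartCoord_secondFundamentalForm hf hΓ hΓ', chartCoord_secondFundamentalForm hf hΓ hΓ',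
    chartSecondForm, chartSecondForm, hΓ.symm htor u v, inCharts_extChartAt f hp,
    ← chartCoord_mfderiv hd hp hfp, ← chartCoord_mfderiv hd hp hfp, hΓ'.symm htor',
    (contDiffAt_inCharts (hf p) hp hfp).isSymmSndFDerivAt (by simp; norm_cast) (chartCoord p p u)]

/-- Being induced means that the defect in the Gauss formula is normal; here this is expressed in
charts, in the form required by `chart_gauss`. -/
theorem IsInducedConnection.eventually_normal
    {f : M → N} (hf : ContMDiff 𝓘(ℝ, E) 𝓘(ℝ, E') ∞ f)
    {g : ContMDiffRiemannianMetric 𝓘(ℝ, E') ∞ E' (TangentSpace 𝓘(ℝ, E') : N → Type _)}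
    {p : M} {cov' : CovariantDerivative 𝓘(ℝ, E') E' (TangentSpace 𝓘(ℝ, E') : N → Type _)}
    {cov : CovariantDerivative 𝓘(ℝ, E) E (TangentSpace 𝓘(ℝ, E) : M → Type _)}
    (hind : IsInducedConnection g cov' cov f)
    {Γ : E → E →L[ℝ] E →L[ℝ] E} {Γ' : E' → E' →L[ℝ] E' →L[ℝ] E'} {G : E' → E' →L[ℝ] E' →L[ℝ] ℝ}
    (hΓ : IsChristoffelAt cov p Γ) (hΓ' : IsChristoffelAt cov' (f p) Γ')
    (hG : IsMetricAt g (f p) G) :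
    ∀ᶠ y in 𝓝 (extChartAt 𝓘(ℝ, E) p p), ∀ v w z,
      G (inCharts f p y) (chartSecondForm Γ' Γ (inCharts f p) y v w)
        (fderiv ℝ (inCharts f p) y z) = 0 := by
  filter_upwards [eventually_extChartAt_right_inv (E := E) p,
    eventually_extChartAt_symm_mem_source (E := E) p,
    eventually_extChartAt_symm (hf.continuous.continuousAt.eventually
      (eventually_chart_source (E := E') (f p))),
    eventually_extChartAt_symm (eventually_chartCoord_secondForm hf hΓ hΓ'),
    eventually_extChartAt_symm (hf.continuous.continuousAt.eventually hG.eventually_eq)]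
    with y hr hq hfq h1 h2 v w z
  set q := (extChartAt 𝓘(ℝ, E) p).symm y with hqdef
  have hd := (hf q).mdifferentiableAt (by simp)
  have h3 := hind q _ (mdifferentiableAt_chartField hq w) (chartField p v q) (chartField p z q)
  rw [← sub_eq_zero, ← sub_apply, ← map_sub, h2, h1, chartCoord_mfderiv hd hq hfq,
    chartCoord_chartField hq, chartCoord_chartField hq, ← inCharts_extChartAt f hq, hr] at h3
  exact h3

variable [FiniteDimensional ℝ E]

theorem gauss_equation [T2Space M] [T2Space N]
    {f : M → N} (hf : ContMDiff 𝓘(ℝ, E) 𝓘(ℝ, E') ∞ f)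
    {g : ContMDiffRiemannianMetric 𝓘(ℝ, E') ∞ E' (TangentSpace 𝓘(ℝ, E') : N → Type _)}
    {cov' covs' : CovariantDerivative 𝓘(ℝ, E') E' (TangentSpace 𝓘(ℝ, E') : N → Type _)}
    {cov covs : CovariantDerivative 𝓘(ℝ, E) E (TangentSpace 𝓘(ℝ, E) : M → Type _)}
    (hcov' : CovariantDerivative.ContMDiffCovariantDerivative cov' ∞)
    (hcovs' : CovariantDerivative.ContMDiffCovariantDerivative covs' ∞)
    (hcov : CovariantDerivative.ContMDiffCovariantDerivative cov ∞)
    (hcovs : CovariantDerivative.ContMDiffCovariantDerivative covs ∞)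
    (hdual : ∀ (x : N) (X Y Z : Π y : N, TangentSpace 𝓘(ℝ, E') y),
      MDiffAt (T% X) x → MDiffAt (T% Y) x → MDiffAt (T% Z) x →
        mvfderiv 𝓘(ℝ, E') (fun y ↦ g.inner y (Y y) (Z y)) x (X x)
          = g.inner x (cov' Y x (X x)) (Z x) + g.inner x (Y x) (covs' Z x (X x)))
    (hind : IsInducedConnection g cov' cov f)
    (p : M) (u v w z : TangentSpace 𝓘(ℝ, E) p) :
    g.inner (f p) (curvature cov' (f p) (mfderiv 𝓘(ℝ, E) 𝓘(ℝ, E') f p u)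
        (mfderiv 𝓘(ℝ, E) 𝓘(ℝ, E') f p v) (mfderiv 𝓘(ℝ, E) 𝓘(ℝ, E') f p w))
        (mfderiv 𝓘(ℝ, E) 𝓘(ℝ, E') f p z)
      = g.inner (f p) (mfderiv 𝓘(ℝ, E) 𝓘(ℝ, E') f p (curvature cov p u v w))
          (mfderiv 𝓘(ℝ, E) 𝓘(ℝ, E') f p z)
        + g.inner (f p) (secondFundamentalForm cov' cov f p u w)
          (secondFundamentalForm covs' covs f p v z)
        - g.inner (f p) (secondFundamentalForm cov' cov f p v w)
          (secondFundamentalForm covs' covs f p u z) := by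
  obtain ⟨Γ, hΓ⟩ := exists_isChristoffelAt hcov p
  obtain ⟨Γs, hΓs⟩ := exists_isChristoffelAt hcovs p
  obtain ⟨Γ', hΓ'⟩ := exists_isChristoffelAt hcov' (f p)
  obtain ⟨Γs', hΓs'⟩ := exists_isChristoffelAt hcovs' (f p)
  obtain ⟨G, hG⟩ := exists_isMetricAt g (f p)
  have hp := mem_chart_source E p
  have hfp := mem_chart_source E' (f p)
  have hd := (hf p).mdifferentiableAt (by simp)
  have e0 := inCharts_extChartAt (E := E) (E' := E') f hp
  have hn := hind.eventually_normal hf hΓ hΓ' hG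
  have h := chart_gauss (Γs := Γs) (Γs' := Γs')
    ((contDiffAt_inCharts (hf p) hp hfp).of_le (by norm_cast)) hΓ.differentiableAt
    (by rw [e0]; exact hΓ'.differentiableAt)
    (by rw [e0]; exact hG.eventually_differentiableAt.self_of_nhds)
    (by rw [e0]; exact (IsMetricAt.fderiv_eq hdual hG hΓ' hΓs').self_of_nhds)
    hn (chartCoord p p u) (chartCoord p p v) (chartCoord p p w) (chartCoord p p z)
  simp only [hG.eventually_eq.self_of_nhds, hΓ'.chartCoord_curvature, chartCoord_mfderiv hd hp hfp,
    hΓ.chartCoord_curvature, chartCoord_secondFundamentalForm hf hΓ hΓ',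
    chartCoord_secondFundamentalForm hf hΓs hΓs']
  rwa [e0] at h

theorem inner_curvature_dual [T2Space M]
    {g : ContMDiffRiemannianMetric 𝓘(ℝ, E) ∞ E (TangentSpace 𝓘(ℝ, E) : M → Type _)}
    {cov covs : CovariantDerivative 𝓘(ℝ, E) E (TangentSpace 𝓘(ℝ, E) : M → Type _)}
    (hcov : CovariantDerivative.ContMDiffCovariantDerivative cov ∞)
    (hcovs : CovariantDerivative.ContMDiffCovariantDerivative covs ∞)
    (hdual : ∀ (x : M) (X Y Z : Π y : M, TangentSpace 𝓘(ℝ, E) y),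
      MDiffAt (T% X) x → MDiffAt (T% Y) x → MDiffAt (T% Z) x →
        mvfderiv 𝓘(ℝ, E) (fun y ↦ g.inner y (Y y) (Z y)) x (X x)
          = g.inner x (cov Y x (X x)) (Z x) + g.inner x (Y x) (covs Z x (X x)))
    (p : M) (u v w z : TangentSpace 𝓘(ℝ, E) p) :
    g.inner p (curvature cov p u v w) z = - g.inner p w (curvature covs p u v z) := by
  obtain ⟨Γ, hΓ⟩ := exists_isChristoffelAt hcov p
  obtain ⟨Γs, hΓs⟩ := exists_isChristoffelAt hcovs p
  obtain ⟨G, hG⟩ := exists_isMetricAt g p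
  simp only [hG.eventually_eq.self_of_nhds, hΓ.chartCoord_curvature, hΓs.chartCoord_curvature]
  exact chart_curvature_dual hΓ.differentiableAt hΓs.differentiableAt
    hG.eventually_differentiableAt (IsMetricAt.fderiv_eq hdual hG hΓ hΓs) _ _ _ _

end InCharts

/-! ### The Levi-Civita connection of a statistical structure -/

section LeviCivita

variable {E : Type*} [NormedAddCommGroup E] [NormedSpace ℝ E] [FiniteDimensional ℝ E]
  {M : Type*} [TopologicalSpace M] [ChartedSpace E M] [IsManifold 𝓘(ℝ, E) ∞ M]
  {E' : Type*} [NormedAddCommGroup E'] [NormedSpace ℝ E'] [FiniteDimensional ℝ E']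
  {N : Type*} [TopologicalSpace N] [ChartedSpace E' N] [IsManifold 𝓘(ℝ, E') ∞ N]

namespace StatisticalStructure

variable (S : StatisticalStructure 𝓘(ℝ, E) M)

theorem leviCivita_apply (V : Π y : M, TangentSpace 𝓘(ℝ, E) y) (x : M)
    (u : TangentSpace 𝓘(ℝ, E) x) :
    S.leviCivita V x u = (1 / 2 : ℝ) • (S.conn V x u + S.dualConn V x u) := by
  have : S.leviCivita V x u
      = (1 / 2 : ℝ) • S.conn V x u + (1 - 1 / 2 : ℝ) • S.dualConn V x u := rfl
  rw [this]
  module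

theorem smooth_leviCivita : CovariantDerivative.ContMDiffCovariantDerivative S.leviCivita ∞ :=
  CovariantDerivative.ContMDiffCovariantDerivative.affineCombination _ _ contMDiff_const
    S.smooth_conn S.smooth_dualConn

/-- The average of duality with the same identity for Y and Z exchanged. Thus ∇° is its own dual,
and the Gauss equation applies to it with both connections equal. -/
theorem duality_leviCivita (x : M) (X Y Z : Π y : M, TangentSpace 𝓘(ℝ, E) y)
    (hX : MDiffAt (T% X) x) (hY : MDiffAt (T% Y) x) (hZ : MDiffAt (T% Z) x) :
    mvfderiv 𝓘(ℝ, E) (fun y ↦ S.metric.inner y (Y y) (Z y)) x (X x)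
      = S.metric.inner x (S.leviCivita Y x (X x)) (Z x)
        + S.metric.inner x (Y x) (S.leviCivita Z x (X x)) := by
  have h1 := S.duality x X Y Z hX hY hZ
  have h2 := S.duality x X Z Y hX hZ hY
  have h3 : (fun y ↦ S.metric.inner y (Z y) (Y y)) = fun y ↦ S.metric.inner y (Y y) (Z y) :=
    funext fun y ↦ S.metric.symm y _ _
  rw [h3, S.metric.symm x _ (Y x), S.metric.symm x (Z x)] at h2
  simp only [leviCivita_apply, map_add, map_smul, add_apply, smul_apply, smul_eq_mul]
  linarith

end StatisticalStructure

variable {S : StatisticalStructure 𝓘(ℝ, E) M} {T : StatisticalStructure 𝓘(ℝ, E') N} {f : M → N}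

theorem covAlong_leviCivita (V : Π q : M, TangentSpace 𝓘(ℝ, E') (f q)) (p : M)
    (u : TangentSpace 𝓘(ℝ, E) p) :
    covAlong T.leviCivita f V p u
      = (1 / 2 : ℝ) • (covAlong T.conn f V p u + covAlong T.dualConn f V p u) := by
  simp only [covAlong, StatisticalStructure.leviCivita_apply]
  module

theorem secondFundamentalForm_leviCivita (p : M) (u v : TangentSpace 𝓘(ℝ, E) p) :
    secondFundamentalForm T.leviCivita S.leviCivita f p u v
      = (1 / 2 : ℝ) • (secondFundamentalForm T.conn S.conn f p u v
        + secondFundamentalForm T.dualConn S.dualConn f p u v) := by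
  simp only [secondFundamentalForm, covAlong_leviCivita, StatisticalStructure.leviCivita_apply,
    map_smul, map_add]
  module

theorem isInducedConnection_leviCivita (h : IsInducedConnection T.metric T.conn S.conn f)
    (hs : IsInducedConnection T.metric T.dualConn S.dualConn f) :
    IsInducedConnection T.metric T.leviCivita S.leviCivita f := by
  intro p Y hY u w
  have h1 := h p Y hY u w
  have h2 := hs p Y hY u w
  simp only [covAlong_leviCivita, StatisticalStructure.leviCivita_apply, map_add, map_smul,
    add_apply, smul_apply, smul_eq_mul] at h1 h2 ⊢
  rw [h1, h2]

/-- The Gauss equation for ∇ yields products of σ with σ*, which in terms of the half-sum and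
half-difference have opposite signs. Subtracting twice the Gauss equation for ∇° reverses the sign
of the half-sum part, so both quadratic expressions end up subtracted. -/
theorem IsStatisticalSubmanifold.sectionalK_sub_sectionalLC [T2Space M] [T2Space N]
    (hM : IsStatisticalSubmanifold S T f) (p : M) (u v : TangentSpace 𝓘(ℝ, E) p) :
    S.sectionalK p u v - S.sectionalLC p u v
      = (T.metric.inner (f p) (curvature T.conn (f p) (mfderiv 𝓘(ℝ, E) 𝓘(ℝ, E') f p u)
            (mfderiv 𝓘(ℝ, E) 𝓘(ℝ, E') f p v) (mfderiv 𝓘(ℝ, E) 𝓘(ℝ, E') f p v))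
            (mfderiv 𝓘(ℝ, E) 𝓘(ℝ, E') f p u)
          - T.metric.inner (f p) (curvature T.conn (f p) (mfderiv 𝓘(ℝ, E) 𝓘(ℝ, E') f p u)
            (mfderiv 𝓘(ℝ, E) 𝓘(ℝ, E') f p v) (mfderiv 𝓘(ℝ, E) 𝓘(ℝ, E') f p u))
            (mfderiv 𝓘(ℝ, E) 𝓘(ℝ, E') f p v)) / 2
        - 2 * ambientSectionalLC T f p u v
        - (T.metric.inner (f p)
            ((1 / 2 : ℝ) • (secondFundamentalForm T.conn S.conn f p u u
              - secondFundamentalForm T.dualConn S.dualConn f p u u))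
            ((1 / 2 : ℝ) • (secondFundamentalForm T.conn S.conn f p v v
              - secondFundamentalForm T.dualConn S.dualConn f p v v))
          - T.metric.inner (f p)
            ((1 / 2 : ℝ) • (secondFundamentalForm T.conn S.conn f p u v
              - secondFundamentalForm T.dualConn S.dualConn f p u v))
            ((1 / 2 : ℝ) • (secondFundamentalForm T.conn S.conn f p u v
              - secondFundamentalForm T.dualConn S.dualConn f p u v)))
        - (T.metric.inner (f p)
            ((1 / 2 : ℝ) • (secondFundamentalForm T.conn S.conn f p u u
              + secondFundamentalForm T.dualConn S.dualConn f p u u))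
            ((1 / 2 : ℝ) • (secondFundamentalForm T.conn S.conn f p v v
              + secondFundamentalForm T.dualConn S.dualConn f p v v))
          - T.metric.inner (f p)
            ((1 / 2 : ℝ) • (secondFundamentalForm T.conn S.conn f p u v
              + secondFundamentalForm T.dualConn S.dualConn f p u v))
            ((1 / 2 : ℝ) • (secondFundamentalForm T.conn S.conn f p u v
              + secondFundamentalForm T.dualConn S.dualConn f p u v))) := by
  have hf : ContMDiff 𝓘(ℝ, E) 𝓘(ℝ, E') ∞ f := hM.immersion.contMDiff
  have g1 := gauss_equation hf T.smooth_conn T.smooth_dualConn S.smooth_conn S.smooth_dualConn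
    T.duality hM.conn_induced p u v
  have g2 := g1 u v
  have g3 := gauss_equation hf T.smooth_leviCivita T.smooth_leviCivita S.smooth_leviCivita
    S.smooth_leviCivita T.duality_leviCivita
    (isInducedConnection_leviCivita hM.conn_induced hM.dualConn_induced) p u v v u
  -- Duality on M replaces g(R*(u,v)v, u) by -g(R(u,v)u, v), so the Gauss equation for ∇ alone, used
  -- in `g1` and `g2`, covers both curvatures.
  have d1 := inner_curvature_dual S.smooth_conn S.smooth_dualConn S.duality p u v u v
  replace g1 := g1 v u
  rw [S.metric.symm p u] at d1
  rw [← hM.metric_eq] at g1 g2 g3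
  rw [secondFundamentalForm_symm hf T.smooth_conn S.smooth_conn T.torsionFree_conn
    S.torsionFree_conn p v u] at *
  rw [secondFundamentalForm_symm hf T.smooth_dualConn S.smooth_dualConn T.torsionFree_dualConn
    S.torsionFree_dualConn p v u] at *
  simp only [secondFundamentalForm_leviCivita] at g3
  rw [secondFundamentalForm_symm hf T.smooth_conn S.smooth_conn T.torsionFree_conn
    S.torsionFree_conn p v u, secondFundamentalForm_symm hf T.smooth_dualConn S.smooth_dualConn
    T.torsionFree_dualConn S.torsionFree_dualConn p v u] at g3
  unfold StatisticalStructure.sectionalK ambientSectionalLC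
  unfold StatisticalStructure.sectionalLC
  have s1 := T.metric.symm (f p)
  generalize secondFundamentalForm T.conn S.conn f p u u = a at *
  generalize secondFundamentalForm T.conn S.conn f p u v = b at *
  generalize secondFundamentalForm T.conn S.conn f p v v = d at *
  generalize secondFundamentalForm T.dualConn S.dualConn f p u u = a' at *
  generalize secondFundamentalForm T.dualConn S.dualConn f p u v = b' at *
  generalize secondFundamentalForm T.dualConn S.dualConn f p v v = d' at *
  simp only [map_add, map_sub, map_smul, add_apply, sub_apply, smul_apply, smul_eq_mul] at *
  rw [s1 d a, s1 d a', s1 d' a, s1 d' a', s1 b' b] at *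
  linarith

end LeviCivita

/-! ### Totally real submanifolds -/

section TotallyReal

variable {E : Type*} [NormedAddCommGroup E] [NormedSpace ℝ E] [FiniteDimensional ℝ E]
  {M : Type*} [TopologicalSpace M] [ChartedSpace E M] [IsManifold 𝓘(ℝ, E) ∞ M]
  {E' : Type*} [NormedAddCommGroup E'] [NormedSpace ℝ E'] [FiniteDimensional ℝ E']
  {N : Type*} [TopologicalSpace N] [ChartedSpace E' N] [IsManifold 𝓘(ℝ, E') ∞ N]
  {S : StatisticalStructure 𝓘(ℝ, E) M} {T : StatisticalStructure 𝓘(ℝ, E') N} {f : M → N}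
  {Λ : Π x : N, Submodule ℝ (TangentSpace 𝓘(ℝ, E') x →L[ℝ] TangentSpace 𝓘(ℝ, E') x)} {c : ℝ}

/-- Every quaternionic term in the curvature formula is a multiple of some J_α applied to a tangent
vector of M. Such a vector is normal, so it vanishes against `z` and only the constant curvature
part survives. -/
theorem IsTotallyReal.inner_curvature (hreal : IsTotallyReal (I := 𝓘(ℝ, E)) T Λ f)
    (hN : IsQuaternionKaehlerLike T Λ c) (hM : IsStatisticalSubmanifold S T f)
    (p : M) (u v w z : TangentSpace 𝓘(ℝ, E) p) :
    T.metric.inner (f p) (curvature T.conn (f p) (mfderiv 𝓘(ℝ, E) 𝓘(ℝ, E') f p u)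
        (mfderiv 𝓘(ℝ, E) 𝓘(ℝ, E') f p v) (mfderiv 𝓘(ℝ, E) 𝓘(ℝ, E') f p w))
        (mfderiv 𝓘(ℝ, E) 𝓘(ℝ, E') f p z)
      = c / 4 * (S.metric.inner p v w * S.metric.inner p u z
        - S.metric.inner p u w * S.metric.inner p v z) := by
  obtain ⟨U, J, hU, hJ⟩ := hN.quaternionic (f p)
  have hJΛ (α) : J α (f p) ∈ Λ (f p) := by
    rw [← hJ.span_eq _ hU]
    exact Submodule.subset_span ⟨α, rfl⟩
  have h0 (α) (u v : TangentSpace 𝓘(ℝ, E) p) := hreal p _ (hJΛ α) u v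
  rw [hN.curvature_eq U J hJ _ hU]
  simp only [map_smul, map_add, map_sub, map_sum, smul_apply, add_apply, sub_apply,
    sum_apply, h0, smul_eq_mul, mul_zero, sub_zero, Finset.sum_const_zero, add_zero, hM.metric_eq]

theorem IsTotallyReal.sectionalK_sub_sectionalLC [T2Space M] [T2Space N]
    (hreal : IsTotallyReal (I := 𝓘(ℝ, E)) T Λ f)
    (hN : IsQuaternionKaehlerLike T Λ c) (hM : IsStatisticalSubmanifold S T f)
    {p : M} {n : ℕ} {e : Fin n → TangentSpace 𝓘(ℝ, E) p} (he : S.IsOrthonormal p e)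
    {a b : Fin n} (hab : a ≠ b) :
    S.sectionalK p (e a) (e b) - S.sectionalLC p (e a) (e b)
      = c / 4 - 2 * ambientSectionalLC T f p (e a) (e b)
        - (T.metric.inner (f p)
            ((1 / 2 : ℝ) • (secondFundamentalForm T.conn S.conn f p (e a) (e a)
              - secondFundamentalForm T.dualConn S.dualConn f p (e a) (e a)))
            ((1 / 2 : ℝ) • (secondFundamentalForm T.conn S.conn f p (e b) (e b)
              - secondFundamentalForm T.dualConn S.dualConn f p (e b) (e b)))
          - T.metric.inner (f p)
            ((1 / 2 : ℝ) • (secondFundamentalForm T.conn S.conn f p (e a) (e b)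
              - secondFundamentalForm T.dualConn S.dualConn f p (e a) (e b)))
            ((1 / 2 : ℝ) • (secondFundamentalForm T.conn S.conn f p (e a) (e b)
              - secondFundamentalForm T.dualConn S.dualConn f p (e a) (e b))))
        - (T.metric.inner (f p)
            ((1 / 2 : ℝ) • (secondFundamentalForm T.conn S.conn f p (e a) (e a)
              + secondFundamentalForm T.dualConn S.dualConn f p (e a) (e a)))
            ((1 / 2 : ℝ) • (secondFundamentalForm T.conn S.conn f p (e b) (e b)
              + secondFundamentalForm T.dualConn S.dualConn f p (e b) (e b)))
          - T.metric.inner (f p)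
            ((1 / 2 : ℝ) • (secondFundamentalForm T.conn S.conn f p (e a) (e b)
              + secondFundamentalForm T.dualConn S.dualConn f p (e a) (e b)))
            ((1 / 2 : ℝ) • (secondFundamentalForm T.conn S.conn f p (e a) (e b)
              + secondFundamentalForm T.dualConn S.dualConn f p (e a) (e b)))) := by
  rw [hM.sectionalK_sub_sectionalLC, hreal.inner_curvature hN hM, hreal.inner_curvature hN hM,
    he, he, he, he, if_pos rfl, if_pos rfl, if_neg hab, if_neg hab.symm]
  ring

theorem sum_Ioi_const (n : ℕ) (r : ℝ) :
    ∑ a : Fin n, ∑ _b ∈ Finset.Ioi a, r = (n : ℝ) * (n - 1) / 2 * r := by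
  simp only [Finset.sum_const, Fin.card_Ioi, nsmul_eq_mul, ← Finset.sum_mul]
  congr 1
  induction n with
  | zero => simp
  | succ n ih =>
    rw [Fin.sum_univ_succ]
    have : ∀ x : Fin n, ((n + 1 - 1 - (x.succ : Fin (n + 1)).val : ℕ) : ℝ)
        = ((n - 1 - x.val : ℕ) : ℝ) := fun x ↦ by
      congr 1
      simp only [Fin.val_succ]
      omega
    simp only [this, ih]
    simp
    ring

/-- The lower bound for `τ - τ°` of minimal totally real statistical submanifolds. -/
theorem IsTotallyReal.le_scalarK_sub_scalarLC [T2Space M] [T2Space N]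
    (hreal : IsTotallyReal (I := 𝓘(ℝ, E)) T Λ f)
    (hN : IsQuaternionKaehlerLike T Λ c) (hM : IsStatisticalSubmanifold S T f)
    {p : M} {n : ℕ} {e : Fin n → TangentSpace 𝓘(ℝ, E) p} (he : S.IsOrthonormal p e)
    (hH : meanCurvature T.conn S.conn f p e = 0)
    (hHs : meanCurvature T.dualConn S.dualConn f p e = 0)
    {i : Fin 4 → Fin n} (hi : Function.Injective i) :
    (S.sectionalK p (e (i 0)) (e (i 1)) - S.sectionalLC p (e (i 0)) (e (i 1)))
        + (S.sectionalK p (e (i 2)) (e (i 3)) - S.sectionalLC p (e (i 2)) (e (i 3)))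
        + ((n : ℝ) ^ 2 - n - 4) * (c / 8)
        - 2 * (ambientScalarLC T f p e
          - ambientSectionalLC T f p (e (i 0)) (e (i 1))
          - ambientSectionalLC T f p (e (i 2)) (e (i 3)))
      ≤ S.scalarK p e - S.scalarLC p e := by
  have hn : (1 / (n : ℝ)) ≠ 0 := by
    have : n ≠ 0 := by
      rintro rfl
      exact (i 0).elim0
    positivity
  have hσ := (smul_eq_zero.1 hH).resolve_left hn
  have hσs := (smul_eq_zero.1 hHs).resolve_left hn
  have hf : ContMDiff 𝓘(ℝ, E) 𝓘(ℝ, E') ∞ f := hM.immersion.contMDiff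
  have sσ := secondFundamentalForm_symm hf T.smooth_conn S.smooth_conn T.torsionFree_conn
    S.torsionFree_conn p
  have sσs := secondFundamentalForm_symm hf T.smooth_dualConn S.smooth_dualConn
    T.torsionFree_dualConn S.torsionFree_dualConn p
  -- The algebraic inequality is used twice with the ambient metric, on the half-difference and on
  -- the half-sum of the second fundamental forms; both are traceless because H = H* = 0.
  let B : TangentSpace 𝓘(ℝ, E') (f p) →ₗ[ℝ] TangentSpace 𝓘(ℝ, E') (f p) →ₗ[ℝ] ℝ :=
    LinearMap.mk₂ ℝ (fun v w ↦ T.metric.inner (f p) v w) (by simp) (by simp) (by simp) (by simp)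
  have hB (v w) : B v w = T.metric.inner (f p) v w := rfl
  have hpos (v) : 0 ≤ B v v := by
    rcases eq_or_ne v 0 with rfl | hv
    · simp
    · exact (T.metric.pos (f p) v hv).le
  have h1 := sum_pairs_le_of_trace_eq_zero B (T.metric.symm (f p)) hpos
    (fun a b ↦ (1 / 2 : ℝ) • (secondFundamentalForm T.conn S.conn f p (e a) (e b)
      - secondFundamentalForm T.dualConn S.dualConn f p (e a) (e b)))
    (fun a b ↦ by rw [sσ, sσs])
    (by rw [← Finset.smul_sum, Finset.sum_sub_distrib, hσ, hσs, sub_zero, smul_zero]) i hi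
  have h2 := sum_pairs_le_of_trace_eq_zero B (T.metric.symm (f p)) hpos
    (fun a b ↦ (1 / 2 : ℝ) • (secondFundamentalForm T.conn S.conn f p (e a) (e b)
      + secondFundamentalForm T.dualConn S.dualConn f p (e a) (e b)))
    (fun a b ↦ by rw [sσ, sσs])
    (by rw [← Finset.smul_sum, Finset.sum_add_distrib, hσ, hσs, add_zero, smul_zero]) i hi
  have key (a b : Fin n) (hab : a ≠ b) := hreal.sectionalK_sub_sectionalLC hN hM he hab
  have hsum : S.scalarK p e - S.scalarLC p e
      = ∑ a, ∑ b ∈ Finset.Ioi a,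
        (S.sectionalK p (e a) (e b) - S.sectionalLC p (e a) (e b)) := by
    simp only [StatisticalStructure.scalarK, StatisticalStructure.scalarLC,
      Finset.sum_sub_distrib]
  rw [Finset.sum_congr rfl fun a _ ↦ Finset.sum_congr rfl fun b hb ↦
    key a b (Finset.mem_Ioi.1 hb).ne] at hsum
  simp only [Finset.sum_sub_distrib, ← Finset.mul_sum] at hsum
  -- The n(n-1)/2 pairs contribute c/4 each; removing the two planes leaves (n(n-1)/2 - 2)·c/4 = (n²
  -- - n - 4)·c/8.
  rw [sum_Ioi_const] at hsum
  have hamb : ambientScalarLC T f p e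
      = ∑ a, ∑ b ∈ Finset.Ioi a, ambientSectionalLC T f p (e a) (e b) := rfl
  have k1 := key _ _ (hi.ne (show (0 : Fin 4) ≠ 1 by decide))
  have k2 := key _ _ (hi.ne (show (2 : Fin 4) ≠ 3 by decide))
  simp only [hB, Finset.sum_sub_distrib] at h1 h2
  rw [hsum, hamb]
  linarith

end TotallyReal
end StatGeom

theorem mainTheorem5 {m n : ℕ}
    {N : Type*} [TopologicalSpace N] [T2Space N] [SecondCountableTopology N]
    [ChartedSpace (EuclideanSpace ℝ (Fin (4 * m))) N] [IsManifold (𝓡 (4 * m)) ∞ N]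
    {M : Type*} [TopologicalSpace M] [T2Space M] [SecondCountableTopology M]
    [ChartedSpace (EuclideanSpace ℝ (Fin n)) M] [IsManifold (𝓡 n) ∞ M]
    (T : StatGeom.StatisticalStructure (𝓡 (4 * m)) N)
    (Λ : Π x : N, Submodule ℝ (TangentSpace (𝓡 (4 * m)) x →L[ℝ] TangentSpace (𝓡 (4 * m)) x))
    (c : ℝ) (hN : StatGeom.IsQuaternionKaehlerLike T Λ c)
    (S : StatGeom.StatisticalStructure (𝓡 n) M) (f : M → N)
    (hM : StatGeom.IsStatisticalSubmanifold S T f)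
    (hreal : StatGeom.IsTotallyReal (I := 𝓡 n) T Λ f)
    (p : M) (e : Fin n → TangentSpace (𝓡 n) p) (he : S.IsOrthonormal p e)
    -- `π₁` is spanned by `e (i 0), e (i 1)` and `π₂` by `e (i 2), e (i 3)`
    (i : Fin 4 → Fin n) (hi : Function.Injective i)
    (hlt : S.scalarK p e - S.scalarLC p e
      < (S.sectionalK p (e (i 0)) (e (i 1)) - S.sectionalLC p (e (i 0)) (e (i 1)))
        + (S.sectionalK p (e (i 2)) (e (i 3)) - S.sectionalLC p (e (i 2)) (e (i 3)))
        + ((n : ℝ) ^ 2 - n - 4) * (c / 8)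
        - 2 * (StatGeom.ambientScalarLC T f p e
          - StatGeom.ambientSectionalLC T f p (e (i 0)) (e (i 1))
          - StatGeom.ambientSectionalLC T f p (e (i 2)) (e (i 3)))) :
    ¬ StatGeom.IsMinimal S T f := by
  intro hmin
  obtain ⟨hH, hHs⟩ := hmin n finrank_euclideanSpace_fin.symm p e he
  exact hlt.not_ge (hreal.le_scalarK_sub_scalarLC hN hM he hH hHs hi)
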